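/- Let $n$ sensors be connected by a directed graph $\mathcal G$ on $\{1,\dots,n\}$ without self-loops, let $\mathcal N_i$ be the set of nodes $j$ with an arc from $j$ to $i$, and let $\gamma_{ij}>0$ for $j\in\mathcal N_i$ and $\gamma_{ij}=0$ otherwise. Assume that $\mathcal G$ has a (directed, rooted) spanning tree. Let $\{x(t)\}_{t\ge 0}$ be an i.i.d. real random sequence with $E\,x(t)=\bar x$, $E\,x(t)^2=s^2$, $s^2-\bar x^2>0$ and $E\,x(t)^4<\infty$. Sensor $i$ produces $y_i^\eta(t)=\alpha_i x(t)+\beta_i+\eta_i(t)$, with constants $\alpha_i\neq 0$, $\beta_i\in\mathbb R$, where $\{\eta_i(t)\}_{t\ge0}$, $i=1,\dots,n$, are mutually independent zero-mean i.i.d. sequences with $E\,\eta_i(t)^2=\sigma_i^2$ and $E\,\eta_i(t)^4<\infty$, jointly independent of $\{x(t)\}$. Let $\delta(t)>0$ with $\sum_{t}\delta(t)=\infty$ and $\sum_t\delta(t)^2<\infty$. Let $\hat\theta_i(t)=[\hat a_i(t)\ \hat b_i(t)]^T$ be generated by $\hat\theta_i(0)=[1\ \ 0]^T$ and $$\hat\theta_i(t+1)=\hat\theta_i(t)+\delta(t)\Big\{\sum_{j\in\mathcal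 N_i}\gamma_{ij}\big(\hat z_j^\eta(t)-\hat z_i^\eta(t)\big)\begin{bmatrix}y_i^\eta(t)\\1\end{bmatrix}+\begin{bmatrix}\sigma_i^2\sum_{j\in\mathcal N_i}\gamma_{ij}&0\\0&0\end{bmatrix}\hat\theta_i(t)\Big\},$$ where $\hat z_i^\eta(t)=\hat a_i(t)y_i^\eta(t)+\hat b_i(t)$. Let $\hat\rho(t)\in\mathbb R^{2n}$ be the stacked vector of the pairs $\hat\rho_i(t)=[\hat a_i(t)\alpha_i\ \ \ \hat a_i(t)\beta_i+\hat b_i(t)]^T$, so that $\hat\rho_i(0)=[\alpha_i\ \ \beta_i]^T$. Let $\Gamma$ be the $n\times n$ matrix with off-diagonal entries $\gamma_{ij}$ and diagonal entries $-\sum_{j\ne i}\gamma_{ij}$, and let $\bar B=\mathrm{diag}\{\bar\Phi_1,\dots,\bar\Phi_n\}(\Gamma\otimes I_2)$ with $$\bar\Phi_i=\begin{bmatrix}\alpha_i\beta_i\bar x+\alpha_i^2s^2&\alpha_i\beta_i+\alpha_i^2\bar x\\(1+\beta_i^2)\bar x+\alpha_i\beta_is^2&1+\beta_i^2+\alpha_i\beta_i\bar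 x\end{bmatrix}.$$ Put $i_1=[1\ 0\ 1\ 0\ \cdots\ 1\ 0]^T$ and $i_2=[0\ 1\ 0\ 1\ \cdots\ 0\ 1]^T$ in $\mathbb R^{2n}$. Then there is exactly one pair of row vectors $\pi_1',\pi_2'$ with $\pi_k'\bar B=0$ and $\pi_k'i_l=1$ if $k=l$ and $0$ otherwise ($k,l\in\{1,2\}$), and there are square-integrable random variables $w_1,w_2$ such that $\hat\rho(t)\to i_1w_1+i_2w_2$ as $t\to\infty$, both in the mean square sense and with probability one, and $E\{w_1\}=\pi_1'\hat\rho(0)$, $E\{w_2\}=\pi_2'\hat\rho(0)$. -/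

import Mathlib

open MeasureTheory ProbabilityTheory Filter Topology
open scoped Matrix Kronecker

namespace BlindCalibration

/-- `T` is a spanning tree of the digraph `G` rooted at `r`: a subgraph of `G` in which `r` has no
incoming arc, every other node has exactly one, and every node is reachable from `r`. -/
structure IsSpanningTree {V : Type*} (T G : Digraph V) (r : V) : Prop where
  le : T ≤ G
  root : ∀ u, ¬ T.Adj u r
  parent : ∀ v, v ≠ r → ∃! u, T.Adj u v
  reach : ∀ v, Relation.ReflTransGen T.Adj r v

/-- `G` has a (directed, rooted) spanning tree. -/
def HasSpanningTree {V : Type*} (G : Digraph V) : Prop :=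
  ∃ (r : V) (T : Digraph V), IsSpanningTree T G r

open Classical in
/-- The neighbours of node `i`: the nodes `j` that can send their messages to `i`
(`G.Adj j i` is an arc from `j` to `i`). -/
noncomputable def nbrs {n : ℕ} (G : Digraph (Fin n)) (i : Fin n) : Finset (Fin n) :=
  Finset.univ.filter fun j => G.Adj j i

/-- Noisy sensor outputs `y_i(t) = α_i x(t) + β_i + η_i(t)` along one realization. -/
def noisyOutput {n : ℕ} (α β : Fin n → ℝ) (x : ℕ → ℝ) (η : Fin n → ℕ → ℝ) :
    ℕ → Fin n → ℝ :=
  fun t i => α i * x t + β i + η i t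

/-- Calibrated output `z_i = a_i y_i + b_i`, where `θ i = (a_i, b_i)`. -/
def calibrated {n : ℕ} (θ : Fin n → Fin 2 → ℝ) (y : Fin n → ℝ) (i : Fin n) : ℝ :=
  θ i 0 * y i + θ i 1

/-- Initial calibration parameters `(a_i, b_i) = (1, 0)`. -/
def thetaInit (n : ℕ) : Fin n → Fin 2 → ℝ := fun _ => ![1, 0]

/-- One iteration, with step size `d`, of the bias-compensated calibration algorithm, given the
current sensor outputs `y`. -/
noncomputable def step {n : ℕ} (G : Digraph (Fin n)) (γ : Fin n → Fin n → ℝ) (σ : Fin n → ℝ)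
    (d : ℝ) (y : Fin n → ℝ) (θ : Fin n → Fin 2 → ℝ) : Fin n → Fin 2 → ℝ :=
  fun i => θ i + d •
    ((∑ j ∈ nbrs G i, (γ i j * (calibrated θ y j - calibrated θ y i)) • ![y i, 1])
      + !![σ i ^ 2 * ∑ j ∈ nbrs G i, γ i j, 0; 0, 0] *ᵥ θ i)

/-- The parameter estimates generated by the algorithm from the sensor output sequence `y`. -/
noncomputable def thetaHat {n : ℕ} (G : Digraph (Fin n)) (γ : Fin n → Fin n → ℝ)
    (σ : Fin n → ℝ) (δ : ℕ → ℝ) (y : ℕ → Fin n → ℝ) : ℕ → Fin n → Fin 2 → ℝ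
  | 0 => thetaInit n
  | t + 1 => step G γ σ (δ t) (y t) (thetaHat G γ σ δ y t)

/-- The stacked vector in `ℝ^{2n}` of equivalent gains and offsets
`(g_i, f_i) = (a_i α_i, a_i β_i + b_i)`; the entry `(i, 0)` is `g_i` and `(i, 1)` is `f_i`. -/
def rhoOf {n : ℕ} (α β : Fin n → ℝ) (θ : Fin n → Fin 2 → ℝ) : Fin n × Fin 2 → ℝ :=
  fun p => (!![α p.1, 0; β p.1, 1] *ᵥ θ p.1) p.2

/-- The process of equivalent gains and offsets generated by the algorithm from the random signal
`x` and the random measurement noises `η`. -/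
noncomputable def rhoHat {Ω : Type*} {n : ℕ} (G : Digraph (Fin n)) (γ : Fin n → Fin n → ℝ)
    (α β σ : Fin n → ℝ) (δ : ℕ → ℝ) (x : ℕ → Ω → ℝ) (η : Fin n → ℕ → Ω → ℝ)
    (t : ℕ) (ω : Ω) : Fin n × Fin 2 → ℝ :=
  rhoOf α β (thetaHat G γ σ δ
    (noisyOutput α β (fun k => x k ω) (fun i k => η i k ω)) t)

/-- The weight matrix `Γ`: off-diagonal entries `γ_ij`, diagonal entries `-∑_{j ≠ i} γ_ij`. -/
def weightMatrix {n : ℕ} (γ : Fin n → Fin n → ℝ) : Matrix (Fin n) (Fin n) ℝ :=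
  Matrix.of fun i j =>
    if i = j then -∑ k ∈ Finset.univ.filter (fun k => k ≠ i), γ i k else γ i j

/-- The `2 × 2` block `Φ̄_i`, for a signal with first moment `xbar` and second moment `s ^ 2`. -/
def phiBar (a b xbar s : ℝ) : Matrix (Fin 2) (Fin 2) ℝ :=
  !![a * b * xbar + a ^ 2 * s ^ 2, a * b + a ^ 2 * xbar;
     (1 + b ^ 2) * xbar + a * b * s ^ 2, 1 + b ^ 2 + a * b * xbar]

/-- `Φ̄ = diag(Φ̄_1, …, Φ̄_n)`. -/
def PhiBar {n : ℕ} (α β : Fin n → ℝ) (xbar s : ℝ) : Matrix (Fin n × Fin 2) (Fin n × Fin 2) ℝ :=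
  Matrix.of fun p q => if p.1 = q.1 then phiBar (α p.1) (β p.1) xbar s p.2 q.2 else 0

/-- `B̄ = Φ̄ (Γ ⊗ I₂)`. -/
def BBar {n : ℕ} (γ : Fin n → Fin n → ℝ) (α β : Fin n → ℝ) (xbar s : ℝ) :
    Matrix (Fin n × Fin 2) (Fin n × Fin 2) ℝ :=
  PhiBar α β xbar s * (weightMatrix γ ⊗ₖ (1 : Matrix (Fin 2) (Fin 2) ℝ))

/-- `i₁ = (1, 0, 1, 0, …, 1, 0)`. -/
def vecI1 (n : ℕ) : Fin n × Fin 2 → ℝ := fun p => ![1, 0] p.2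

/-- `i₂ = (0, 1, 0, 1, …, 0, 1)`. -/
def vecI2 (n : ℕ) : Fin n × Fin 2 → ℝ := fun p => ![0, 1] p.2

/-- `p₁, p₂` are left eigenvectors of `B` for the eigenvalue zero, normalized by
`[p₁; p₂] [i₁ i₂] = I₂`. -/
structure IsNormalizedLeftPair {n : ℕ} (B : Matrix (Fin n × Fin 2) (Fin n × Fin 2) ℝ)
    (p₁ p₂ : Fin n × Fin 2 → ℝ) : Prop where
  left₁ : p₁ ᵥ* B = 0
  left₂ : p₂ ᵥ* B = 0
  norm₁₁ : p₁ ⬝ᵥ vecI1 n = 1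
  norm₁₂ : p₁ ⬝ᵥ vecI2 n = 0
  norm₂₁ : p₂ ⬝ᵥ vecI1 n = 0
  norm₂₂ : p₂ ⬝ᵥ vecI2 n = 1

/-- Mean square convergence of a sequence of random vectors (all with finite second moments). -/
def TendstoMeanSquare {Ω ι : Type*} [MeasurableSpace Ω] [Fintype ι] (μ : Measure Ω)
    (X : ℕ → Ω → ι → ℝ) (Y : Ω → ι → ℝ) : Prop :=
  (∀ t p, MemLp (fun ω => X t ω p) 2 μ) ∧ (∀ p, MemLp (fun ω => Y ω p) 2 μ) ∧
    Tendsto (fun t => ∫ ω, ∑ p, (X t ω p - Y ω p) ^ 2 ∂μ) atTop (𝓝 0)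

/-- Convergence with probability one of a sequence of random vectors. -/
def TendstoAlmostSurely {Ω ι : Type*} [MeasurableSpace Ω] (μ : Measure Ω)
    (X : ℕ → Ω → ι → ℝ) (Y : Ω → ι → ℝ) : Prop :=
  ∀ᵐ ω ∂μ, Tendsto (fun t => X t ω) atTop (𝓝 (Y ω))

end BlindCalibration

open BlindCalibration

/-! Write C_i = [[α_i, 0], [β_i, 1]] and let R = [[s², x̄], [x̄, 1]] be the second-moment matrix of
(x(t), 1), which is positive definite because the signal has positive variance. In the coordinates ρ
the algorithm is a linear recursion ρ(t+1) = (1 + δ(t) B_t) ρ(t), where B_t depends only on the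
samples taken at time t and so is independent of the past. The noise of node i enters both its
regressor and its own output; the σ_i² term removes exactly this bias, so that E B_t = B̄
(`rhoOf_step`, `mean_identity`).

The algebra rests on the factorization Φ̄_i = C_i C_i' R: each block is positive and self-adjoint
for the inner product of R. Maximum-principle arguments on the graph then show that the kernel of B̄
consists of the consensus vectors (the spanning tree is used here), that it meets the range only in
zero (`eq_zero_of_BBar_mulVec_eq_consensus`), and that for small ε > 0 every eigenvalue of 1 + εB̄
other than 1 lies in the open unit disc (`exists_BBar_eigenvector_eq_zero`). Hence π_1, π_2 exist,
are unique, and define the projection P onto consensus along the range, and the powers of 1 + εB̄ -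
P tend to zero. `exists_lyapunov` turns this into one quadratic form |Lv|², null on consensus, that
contracts by 1 - cδ for every step size δ in [0, ε].

The noise (B_t - B̄)ρ(t) is a martingale difference whose variance is at most a constant times
E|ρ(t)|². As ∑δ² < ∞, a Gronwall argument bounds the second moments, and the martingale S_t =
∑_{i<t} δ(i)·noise_i converges to some S_∞ in L² and almost surely. Since PB̄ = 0, Pρ(t) = P(ρ(0) +
S_t) converges too. The part transversal to consensus vanishes because ∑δ = ∞, both in mean square
and path by path (`tendsto_of_perturbed_recursion`). The limit is P(ρ(0) + S_∞), so w_k = π_k'(ρ(0)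
+ S_∞), and E S_∞ = 0 gives the means. -/

/-! ### Powers of stable matrices and a common Lyapunov form -/

/-- A real matrix all of whose complex eigenvalues have modulus less than one has powers tending
to zero. -/
theorem tendsto_matrix_pow_zero {ι : Type*} [Fintype ι] [DecidableEq ι] [Nonempty ι]
    (A : Matrix ι ι ℝ)
    (h : ∀ (z : ℂ) (v : ι → ℂ), v ≠ 0 → A.map (fun r => (r : ℂ)) *ᵥ v = z • v → ‖z‖ < 1)
    (p q : ι) : Tendsto (fun k => (A ^ k) p q) atTop (𝓝 0) := by
  let _ : NormedRing (Matrix ι ι ℂ) := Matrix.linftyOpNormedRing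
  let _ : NormedAlgebra ℂ (Matrix ι ι ℂ) := Matrix.linftyOpNormedAlgebra
  set M : Matrix ι ι ℂ := A.map (fun r => (r : ℂ)) with hM
  have hlt : spectralRadius ℂ M < 1 := by
    have : spectralRadius ℂ M < ((1 : NNReal) : ENNReal) := by
      refine spectrum.spectralRadius_lt_of_forall_lt M fun z hz => ?_
      rw [spectrum.mem_iff, Matrix.isUnit_iff_isUnit_det, isUnit_iff_ne_zero, not_not,
        ← Matrix.exists_mulVec_eq_zero_iff] at hz
      obtain ⟨v, hv, hz⟩ := hz
      have := h z v hv (by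
        rw [Matrix.sub_mulVec, Algebra.algebraMap_eq_smul_one, Matrix.smul_mulVec,
          Matrix.one_mulVec, sub_eq_zero] at hz
        exact hz.symm)
      exact_mod_cast this
    simpa using this
  -- Gelfand's formula: once `r` lies strictly between the spectral radius and 1, `‖M ^ k‖ ≤ r ^ k`
  -- for all large `k`.
  obtain ⟨r, hr1, hr2⟩ := ENNReal.lt_iff_exists_nnreal_btwn.1 hlt
  have hr2' : r < 1 := by exact_mod_cast hr2
  have hG := spectrum.pow_nnnorm_pow_one_div_tendsto_nhds_spectralRadius M
  have hev : ∀ᶠ k : ℕ in atTop, ‖(A ^ k) p q‖ ≤ (r : ℝ) ^ k := by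
    filter_upwards [hG.eventually_lt_const hr1, eventually_gt_atTop 0] with k hk hk0
    have h1 : ‖M ^ k‖ ≤ (r : ℝ) ^ k := by
      have h2 : ((‖M ^ k‖₊ : ENNReal) ^ (1 / k : ℝ)) ^ (k : ℝ) ≤ (r : ENNReal) ^ (k : ℝ) :=
        ENNReal.rpow_le_rpow hk.le (by positivity)
      rw [← ENNReal.rpow_mul, one_div, inv_mul_cancel₀ (by positivity), ENNReal.rpow_one,
        ENNReal.rpow_natCast] at h2
      exact_mod_cast h2
    have h3 : (M ^ k) p q = (((A ^ k) p q : ℝ) : ℂ) := by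
      have : M ^ k = (A ^ k).map (fun r => (r : ℂ)) :=
        (map_pow (Complex.ofRealHom.mapMatrix (m := ι)) A k).symm
      rw [this]; rfl
    have h4 : ‖(M ^ k) p q‖ ≤ ‖M ^ k‖ := by
      have h5 : ‖(M ^ k) p q‖₊ ≤ ‖M ^ k‖₊ := by
        rw [Matrix.linfty_opNNNorm_def]
        exact (Finset.single_le_sum (f := fun j => ‖(M ^ k) p j‖₊) (fun _ _ => zero_le)
          (Finset.mem_univ q)).trans
          (Finset.le_sup (f := fun i => ∑ j, ‖(M ^ k) i j‖₊) (Finset.mem_univ p))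
      exact_mod_cast h5
    rw [h3, Complex.norm_real] at h4
    exact h4.trans h1
  exact squeeze_zero_norm' hev (tendsto_pow_atTop_nhds_zero_of_lt_one r.2 hr2')

/-- The sum of the squares of the entries of a matrix. -/
noncomputable def entrySq {κ ι : Type*} [Fintype κ] [Fintype ι] (A : Matrix κ ι ℝ) : ℝ :=
  ∑ k, ∑ i, A k i ^ 2

theorem entrySq_nonneg {κ ι : Type*} [Fintype κ] [Fintype ι] (A : Matrix κ ι ℝ) :
    0 ≤ entrySq A :=
  Finset.sum_nonneg fun _ _ => Finset.sum_nonneg fun _ _ => sq_nonneg _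

theorem dotProduct_self_nonneg_real {ι : Type*} [Fintype ι] (v : ι → ℝ) : 0 ≤ v ⬝ᵥ v :=
  Finset.sum_nonneg fun _ _ => mul_self_nonneg _

theorem sq_dotProduct_le {ι : Type*} [Fintype ι] (u v : ι → ℝ) :
    (u ⬝ᵥ v) ^ 2 ≤ (u ⬝ᵥ u) * (v ⬝ᵥ v) := by
  have := Finset.sum_mul_sq_le_sq_mul_sq Finset.univ u v
  simpa [dotProduct, sq] using this

theorem mulVec_dotProduct_self_le {κ ι : Type*} [Fintype κ] [Fintype ι] (A : Matrix κ ι ℝ)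
    (v : ι → ℝ) : (A *ᵥ v) ⬝ᵥ (A *ᵥ v) ≤ entrySq A * (v ⬝ᵥ v) := by
  rw [entrySq, Finset.sum_mul]
  refine Finset.sum_le_sum fun k _ => ?_
  have := sq_dotProduct_le (A k) v
  simpa [Matrix.mulVec, dotProduct, sq] using this

theorem dotProduct_self_convex {ι : Type*} [Fintype ι] (a b : ι → ℝ) {t : ℝ} (h0 : 0 ≤ t)
    (h1 : t ≤ 1) :
    ((1 - t) • a + t • b) ⬝ᵥ ((1 - t) • a + t • b) ≤ (1 - t) * (a ⬝ᵥ a) + t * (b ⬝ᵥ b) := by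
  simp only [dotProduct, Finset.mul_sum, ← Finset.sum_add_distrib]
  refine Finset.sum_le_sum fun i _ => ?_
  simp only [Pi.add_apply, Pi.smul_apply, smul_eq_mul]
  nlinarith [mul_nonneg (mul_nonneg h0 (sub_nonneg.2 h1)) (sq_nonneg (a i - b i))]

theorem dotProduct_self_add_le {ι : Type*} [Fintype ι] (a b : ι → ℝ) {t : ℝ} (ht : 0 < t) :
    (a + b) ⬝ᵥ (a + b) ≤ (1 + t) * (a ⬝ᵥ a) + (1 + 1 / t) * (b ⬝ᵥ b) := by
  simp only [dotProduct, Finset.mul_sum, ← Finset.sum_add_distrib]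
  refine Finset.sum_le_sum fun i _ => ?_
  simp only [Pi.add_apply]
  have : 0 ≤ (t * a i - b i) ^ 2 / t := by positivity
  have h2 : (t * a i - b i) ^ 2 / t = t * (a i * a i) - 2 * a i * b i + 1 / t * (b i * b i) := by
    field_simp
    ring
  linarith

/-- A common Lyapunov matrix for the maps `1 + δ B`, `0 ≤ δ ≤ ε`, transversally to the range of the
projection `P` onto the kernel of `B`. -/
theorem exists_lyapunov {ι : Type*} [Fintype ι] [DecidableEq ι] (B P : Matrix ι ι ℝ) {ε : ℝ}
    (hε : 0 < ε) (hPB : P * B = 0) (hBP : B * P = 0) (hPP : P * P = P)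
    (hT : ∀ p q, Tendsto (fun k => ((1 + ε • B - P : Matrix ι ι ℝ) ^ k) p q) atTop (𝓝 0)) :
    ∃ (m : ℕ) (L : Matrix (Fin m × ι) ι ℝ) (c C : ℝ), 0 < c ∧ 0 < C ∧ L * P = 0 ∧
      (∀ δ, 0 ≤ δ → δ ≤ ε → ∀ v, (L *ᵥ ((1 + δ • B) *ᵥ v)) ⬝ᵥ (L *ᵥ ((1 + δ • B) *ᵥ v)) ≤
        (1 - c * δ) * ((L *ᵥ v) ⬝ᵥ (L *ᵥ v))) ∧
      ∀ v, v ⬝ᵥ v ≤ C * ((L *ᵥ v) ⬝ᵥ (L *ᵥ v) + (P *ᵥ v) ⬝ᵥ (P *ᵥ v)) := by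
  set T : Matrix ι ι ℝ := 1 + ε • B - P with hTdef
  have hsmall : Tendsto (fun k => entrySq (T ^ k)) atTop (𝓝 0) := by
    have : Tendsto (fun k => entrySq (T ^ k)) atTop (𝓝 (∑ _p : ι, ∑ _q : ι, (0 : ℝ) ^ 2)) :=
      tendsto_finsetSum _ fun p _ => tendsto_finsetSum _ fun q _ => (hT p q).pow 2
    simpa using this
  obtain ⟨m, hm, hm1⟩ := ((hsmall.eventually_lt_const (show (0 : ℝ) < 1 / 2 by norm_num)).and
    (eventually_gt_atTop 0)).exists
  -- A truncated version of the series ∑ |T^k e|². It telescopes to V(Te) + |e|² = V(e) + |T^m e|²,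
  -- and `m` was chosen so that the last term is at most |e|²/2.
  let V : (ι → ℝ) → ℝ := fun e => ∑ k ∈ Finset.range m, ((T ^ k) *ᵥ e) ⬝ᵥ ((T ^ k) *ᵥ e)
  let L : Matrix (Fin m × ι) ι ℝ := Matrix.of fun kp q => ((T ^ (kp.1 : ℕ)) * (1 - P)) kp.2 q
  have hL : ∀ v, (L *ᵥ v) ⬝ᵥ (L *ᵥ v) = V ((1 - P) *ᵥ v) := by
    intro v
    simp only [V, Matrix.mulVec_mulVec]
    rw [Finset.sum_range]
    simp only [dotProduct, Fintype.sum_prod_type]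
    rfl
  have hVT : ∀ e, V (T *ᵥ e) ≤ V e - 1 / 2 * (e ⬝ᵥ e) := by
    intro e
    have h1 : V (T *ᵥ e) + e ⬝ᵥ e = V e + ((T ^ m) *ᵥ e) ⬝ᵥ ((T ^ m) *ᵥ e) := by
      have h2 := Finset.sum_range_succ (fun k => ((T ^ k) *ᵥ e) ⬝ᵥ ((T ^ k) *ᵥ e)) m
      rw [Finset.sum_range_succ'] at h2
      simp only [V, Matrix.mulVec_mulVec, ← pow_succ]
      simpa using h2
    have h3 := mulVec_dotProduct_self_le (T ^ m) e
    nlinarith [dotProduct_self_nonneg_real e]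
  have hVle : ∀ e, V e ≤ (∑ k ∈ Finset.range m, entrySq (T ^ k)) * (e ⬝ᵥ e) := by
    intro e
    rw [Finset.sum_mul]
    exact Finset.sum_le_sum fun k _ => mulVec_dotProduct_self_le _ _
  have hVge : ∀ e, e ⬝ᵥ e ≤ V e := by
    intro e
    have := Finset.single_le_sum (f := fun k => ((T ^ k) *ᵥ e) ⬝ᵥ ((T ^ k) *ᵥ e))
      (fun k _ => dotProduct_self_nonneg_real _) (Finset.mem_range.2 hm1)
    simpa using this
  set K := (∑ k ∈ Finset.range m, entrySq (T ^ k)) + 1 with hK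
  have hKpos : 0 < K := by
    have : 0 ≤ ∑ k ∈ Finset.range m, entrySq (T ^ k) :=
      Finset.sum_nonneg fun _ _ => entrySq_nonneg _
    linarith
  -- V loses at least the fraction 1/(2K) of itself under T, and T enters with weight δ/ε: this is
  -- the rate. The constant 2 comes from |a + b|² ≤ 2|a|² + 2|b|².
  refine ⟨m, L, 1 / (2 * ε * K), 2, by positivity, by norm_num, ?_, ?_, ?_⟩
  · have h0 : (1 - P) * P = 0 := by rw [sub_mul, hPP, one_mul, sub_self]
    ext kp q
    have : (T ^ (kp.1 : ℕ) * (1 - P)) * P = 0 := by rw [mul_assoc, h0, mul_zero]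
    exact congrFun (congrFun this kp.2) q
  · intro δ h0 h1 v
    rw [hL, hL]
    set e := (1 - P) *ᵥ v with he
    have hPe : P *ᵥ e = 0 := by
      rw [he, Matrix.mulVec_mulVec, mul_sub, mul_one, hPP, sub_self, Matrix.zero_mulVec]
    -- On the range of `1 - P` the map `1 + δ • B` is a convex combination of the identity and `T`.
    -- As V is convex, the decrease under `T` alone covers all step sizes up to `ε`.
    have h2 : (1 - P) *ᵥ ((1 + δ • B) *ᵥ v) = (1 - δ / ε) • e + (δ / ε) • (T *ᵥ e) := by
      have h3 : T *ᵥ e = e + ε • (B *ᵥ e) := by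
        rw [hTdef, Matrix.sub_mulVec, hPe, Matrix.add_mulVec, Matrix.one_mulVec,
          Matrix.smul_mulVec, sub_zero]
      have h4 : (1 - P) *ᵥ ((1 + δ • B) *ᵥ v) = e + δ • (B *ᵥ e) := by
        rw [he]
        simp only [Matrix.mulVec_mulVec, ← Matrix.smul_mulVec, ← Matrix.add_mulVec]
        congr 1
        rw [sub_mul, one_mul, mul_add, mul_one, Matrix.mul_smul, hPB, mul_sub, hBP]
        simp
        abel
      rw [h3, h4]
      ext i
      simp only [Pi.add_apply, Pi.smul_apply, smul_eq_mul]
      field_simp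
      ring
    have ht0 : 0 ≤ δ / ε := by positivity
    have ht1 : δ / ε ≤ 1 := (div_le_one hε).2 h1
    have h5 : V ((1 - δ / ε) • e + (δ / ε) • (T *ᵥ e)) ≤
        (1 - δ / ε) * V e + δ / ε * V (T *ᵥ e) := by
      simp only [V, Finset.mul_sum, ← Finset.sum_add_distrib]
      refine Finset.sum_le_sum fun k _ => ?_
      rw [Matrix.mulVec_add, Matrix.mulVec_smul, Matrix.mulVec_smul]
      exact dotProduct_self_convex _ _ ht0 ht1
    rw [h2]
    have h6 := hVT e
    have h7 : V e ≤ K * (e ⬝ᵥ e) := by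
      have := hVle e
      nlinarith [dotProduct_self_nonneg_real e]
    have h8 : V e / K ≤ e ⬝ᵥ e := by rw [div_le_iff₀ hKpos]; linarith
    have h9 : δ / ε * V (T *ᵥ e) ≤ δ / ε * (V e - 1 / 2 * (V e / K)) :=
      mul_le_mul_of_nonneg_left (by linarith) ht0
    have h10 : (1 - 1 / (2 * ε * K) * δ) * V e =
        (1 - δ / ε) * V e + δ / ε * (V e - 1 / 2 * (V e / K)) := by
      field_simp
      ring
    linarith
  · intro v
    rw [hL]
    have h1 : v = (1 - P) *ᵥ v + P *ᵥ v := by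
      rw [← Matrix.add_mulVec, sub_add_cancel, Matrix.one_mulVec]
    have h2 := dotProduct_self_add_le ((1 - P) *ᵥ v) (P *ᵥ v) one_pos
    rw [← h1] at h2
    have := hVge ((1 - P) *ᵥ v)
    linarith

/-! ### Kernel and range of `BBar` -/

theorem weightMatrix_sum_smul {n : ℕ} {E : Type*} [AddCommGroup E] [Module ℝ E]
    (γ : Fin n → Fin n → ℝ) (u : Fin n → E) (i : Fin n) :
    ∑ j, weightMatrix γ i j • u j = ∑ j, γ i j • (u j - u i) := by
  rw [← Finset.add_sum_erase _ _ (Finset.mem_univ i),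
    ← Finset.add_sum_erase _ (fun j => γ i j • (u j - u i)) (Finset.mem_univ i)]
  have h1 : weightMatrix γ i i = -∑ k ∈ Finset.univ.erase i, γ i k := by
    simp [weightMatrix, Finset.filter_ne']
  have h2 : ∑ j ∈ Finset.univ.erase i, weightMatrix γ i j • u j =
      ∑ j ∈ Finset.univ.erase i, γ i j • u j :=
    Finset.sum_congr rfl fun j hj => by
      simp [weightMatrix, (Finset.ne_of_mem_erase hj).symm]
  rw [h1, h2, sub_self, smul_zero, zero_add]
  simp only [smul_sub, Finset.sum_sub_distrib, neg_smul, Finset.sum_smul]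
  abel

theorem BBar_apply {n : ℕ} (γ : Fin n → Fin n → ℝ) (α β : Fin n → ℝ) (xbar s : ℝ)
    (p q : Fin n × Fin 2) : BBar γ α β xbar s p q =
      phiBar (α p.1) (β p.1) xbar s p.2 q.2 * weightMatrix γ p.1 q.1 := by
  rw [BBar, Matrix.mul_apply, Fintype.sum_prod_type,
    Finset.sum_eq_single p.1 (fun b _ hb => by simp [PhiBar, hb.symm]) (by simp),
    Finset.sum_eq_single q.2 (fun b _ hb => by simp [Matrix.kroneckerMap_apply, hb]) (by simp)]
  simp [PhiBar, Matrix.kroneckerMap_apply]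

/-- The weighted disagreement `∑ j, γ i j (v j - v i)` of node `i` in the component `c`. -/
def disagreement {n : ℕ} {E : Type*} [AddCommGroup E] [Module ℝ E] (γ : Fin n → Fin n → ℝ)
    (v : Fin n × Fin 2 → E) (i : Fin n) (c : Fin 2) : E :=
  ∑ j, γ i j • (v (j, c) - v (i, c))

/-- Values in an arbitrary real module let one computation serve real vectors (kernel, range) and
complex ones (eigenvectors). -/
theorem BBar_sum_smul {n : ℕ} {E : Type*} [AddCommGroup E] [Module ℝ E]
    (γ : Fin n → Fin n → ℝ) (α β : Fin n → ℝ) (xbar s : ℝ) (v : Fin n × Fin 2 → E)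
    (i : Fin n) (c : Fin 2) : ∑ q, BBar γ α β xbar s (i, c) q • v q =
      phiBar (α i) (β i) xbar s c 0 • disagreement γ v i 0 +
      phiBar (α i) (β i) xbar s c 1 • disagreement γ v i 1 := by
  rw [Fintype.sum_prod_type_right, Fin.sum_univ_two]
  simp only [BBar_apply, mul_smul, ← Finset.smul_sum, disagreement, ← weightMatrix_sum_smul]

theorem BBar_mulVec {n : ℕ} (γ : Fin n → Fin n → ℝ) (α β : Fin n → ℝ) (xbar s : ℝ)
    (v : Fin n × Fin 2 → ℝ) (i : Fin n) (c : Fin 2) : (BBar γ α β xbar s *ᵥ v) (i, c) =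
      phiBar (α i) (β i) xbar s c 0 * disagreement γ v i 0 +
      phiBar (α i) (β i) xbar s c 1 * disagreement γ v i 1 :=
  BBar_sum_smul γ α β xbar s v i c

theorem BBar_map_mulVec {n : ℕ} (γ : Fin n → Fin n → ℝ) (α β : Fin n → ℝ) (xbar s : ℝ)
    (v : Fin n × Fin 2 → ℂ) (i : Fin n) (c : Fin 2) :
    ((BBar γ α β xbar s).map (fun r => (r : ℂ)) *ᵥ v) (i, c) =
      phiBar (α i) (β i) xbar s c 0 * disagreement γ v i 0 +
      phiBar (α i) (β i) xbar s c 1 * disagreement γ v i 1 := by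
  have := BBar_sum_smul γ α β xbar s v i c
  simpa [Matrix.mulVec, dotProduct] using this

/-- Maximum principle: a function without weighted disagreements is maximal at every node from
which all other nodes can be reached. -/
theorem le_root_of_harmonic {n : ℕ} {G : Digraph (Fin n)} {γ : Fin n → Fin n → ℝ}
    (hγpos : ∀ i j, G.Adj j i → 0 < γ i j) (hγ : ∀ i j, 0 ≤ γ i j) {r : Fin n}
    (hr : ∀ v, Relation.ReflTransGen G.Adj r v) (u : Fin n → ℝ)
    (hu : ∀ i, ∑ j, γ i j * (u j - u i) = 0) (i : Fin n) : u i ≤ u r := by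
  obtain ⟨m, -, hm⟩ := Finset.exists_max_image Finset.univ u ⟨i, Finset.mem_univ i⟩
  have key : ∀ v, Relation.ReflTransGen G.Adj v m → u v = u m := by
    intro v hv
    induction hv using Relation.ReflTransGen.head_induction_on with
    | refl => rfl
    | @head a b hab _ ih =>
      have h1 : ∀ j ∈ Finset.univ, γ b j * (u j - u b) ≤ 0 := fun j _ =>
        mul_nonpos_of_nonneg_of_nonpos (hγ b j) (by rw [ih]; linarith [hm j (Finset.mem_univ j)])
      have h2 := (Finset.sum_eq_zero_iff_of_nonpos h1).1 (hu b) a (Finset.mem_univ a)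
      rcases mul_eq_zero.1 h2 with h | h
      · exact absurd h (hγpos b a hab).ne'
      · rw [← ih]; linarith
  rw [key r (hr m)]
  exact hm i (Finset.mem_univ i)

theorem eq_root_of_harmonic {n : ℕ} {G : Digraph (Fin n)} {γ : Fin n → Fin n → ℝ}
    (hγpos : ∀ i j, G.Adj j i → 0 < γ i j) (hγ : ∀ i j, 0 ≤ γ i j) {r : Fin n}
    (hr : ∀ v, Relation.ReflTransGen G.Adj r v) (u : Fin n → ℝ)
    (hu : ∀ i, ∑ j, γ i j * (u j - u i) = 0) (i : Fin n) : u i = u r := by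
  refine le_antisymm (le_root_of_harmonic hγpos hγ hr u hu i) ?_
  have := le_root_of_harmonic hγpos hγ hr (fun i => -u i) (fun i => by
    have := hu i
    calc ∑ j, γ i j * (-u j - -u i) = -∑ j, γ i j * (u j - u i) := by
          rw [← Finset.sum_neg_distrib]; exact Finset.sum_congr rfl fun j _ => by ring
      _ = 0 := by rw [this, neg_zero]) i
  linarith

/-- The block is C C' R with det C = `a` and det R = `s ^ 2 - xbar ^ 2`, both nonzero. -/
theorem phiBar_injective {a b xbar s : ℝ} (ha : a ≠ 0) (hvar : 0 < s ^ 2 - xbar ^ 2) {e₀ e₁ : ℝ}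
    (h0 : phiBar a b xbar s 0 0 * e₀ + phiBar a b xbar s 0 1 * e₁ = 0)
    (h1 : phiBar a b xbar s 1 0 * e₀ + phiBar a b xbar s 1 1 * e₁ = 0) : e₀ = 0 ∧ e₁ = 0 := by
  simp only [phiBar, Matrix.of_apply, Matrix.cons_val', Matrix.cons_val_zero, Matrix.cons_val_one,
    Matrix.cons_val_fin_one] at h0 h1
  have h2 : a * ((a * s ^ 2 + b * xbar) * e₀ + (a * xbar + b) * e₁) = 0 := by linarith
  have h3 : (a * s ^ 2 + b * xbar) * e₀ + (a * xbar + b) * e₁ = 0 :=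
    (mul_eq_zero.1 h2).resolve_left ha
  have h4 : xbar * e₀ + e₁ = 0 := by linear_combination h1 - b * h3
  have h5 : a * (s ^ 2 - xbar ^ 2) * e₀ = 0 := by linear_combination h3 - (a * xbar + b) * h4
  have h6 : e₀ = 0 := (mul_eq_zero.1 h5).resolve_left (mul_ne_zero ha hvar.ne')
  exact ⟨h6, by rw [h6] at h4; linarith⟩

theorem eq_root_of_BBar_mulVec_eq_zero {n : ℕ} {G : Digraph (Fin n)} {γ : Fin n → Fin n → ℝ}
    (hγpos : ∀ i j, G.Adj j i → 0 < γ i j) (hγ : ∀ i j, 0 ≤ γ i j) {r : Fin n}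
    (hr : ∀ v, Relation.ReflTransGen G.Adj r v) {α β : Fin n → ℝ} (hα : ∀ i, α i ≠ 0)
    {xbar s : ℝ} (hvar : 0 < s ^ 2 - xbar ^ 2) {v : Fin n × Fin 2 → ℝ}
    (hv : BBar γ α β xbar s *ᵥ v = 0) (i : Fin n) (c : Fin 2) : v (i, c) = v (r, c) := by
  have h : ∀ i, disagreement γ v i 0 = 0 ∧ disagreement γ v i 1 = 0 := fun i =>
    phiBar_injective (hα i) hvar (by rw [← BBar_mulVec, hv]; rfl) (by rw [← BBar_mulVec, hv]; rfl)
  refine eq_root_of_harmonic hγpos hγ hr (fun i => v (i, c)) (fun i => ?_) i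
  fin_cases c
  · exact (h i).1
  · exact (h i).2

theorem BBar_mulVec_of_consensus {n : ℕ} (γ : Fin n → Fin n → ℝ) (α β : Fin n → ℝ) (xbar s : ℝ)
    {v : Fin n × Fin 2 → ℝ} (hv : ∀ i j c, v (i, c) = v (j, c)) :
    BBar γ α β xbar s *ᵥ v = 0 := by
  have h : ∀ i c, disagreement γ v i c = 0 := fun i c =>
    Finset.sum_eq_zero fun j _ => by rw [hv j i c, sub_self, smul_zero]
  ext ⟨i, c⟩
  rw [BBar_mulVec, h, h]
  simp

/-- No nonzero consensus vector is in the range of `BBar`. -/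
theorem eq_zero_of_BBar_mulVec_eq_consensus {n : ℕ} (hn : 0 < n) {γ : Fin n → Fin n → ℝ}
    (hγ : ∀ i j, 0 ≤ γ i j) {α β : Fin n → ℝ} {xbar s : ℝ} {v : Fin n × Fin 2 → ℝ} {c : Fin 2 → ℝ}
    (hv : ∀ i k, (BBar γ α β xbar s *ᵥ v) (i, k) = c k) : c = 0 := by
  -- This is u_i = c' R v_i. At a maximizing node the weighted disagreement of u is at most 0; but
  -- it equals c' R e with c = C C' R e, hence |C' R e|². So C' R e = 0 and c = 0.
  let u : Fin n → ℝ := fun i =>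
    (s ^ 2 * c 0 + xbar * c 1) * v (i, 0) + (xbar * c 0 + c 1) * v (i, 1)
  obtain ⟨m, -, hm⟩ := Finset.exists_max_image Finset.univ u ⟨⟨0, hn⟩, Finset.mem_univ _⟩
  have h1 : ∑ j, γ m j * (u j - u m) ≤ 0 := Finset.sum_nonpos fun j _ =>
    mul_nonpos_of_nonneg_of_nonpos (hγ m j) (by linarith [hm j (Finset.mem_univ j)])
  have h2 : ∑ j, γ m j * (u j - u m) = (s ^ 2 * c 0 + xbar * c 1) * disagreement γ v m 0 +
      (xbar * c 0 + c 1) * disagreement γ v m 1 := by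
    simp only [disagreement, Finset.mul_sum, ← Finset.sum_add_distrib, smul_eq_mul]
    exact Finset.sum_congr rfl fun j _ => by simp only [u]; ring
  have h3 := hv m 0
  have h4 := hv m 1
  rw [BBar_mulVec] at h3 h4
  simp only [phiBar, Matrix.of_apply, Matrix.cons_val', Matrix.cons_val_zero, Matrix.cons_val_one,
    Matrix.cons_val_fin_one] at h3 h4
  set e₀ := disagreement γ v m 0
  set e₁ := disagreement γ v m 1
  -- The pair `(h, q)` is C' R e for the node `m`.
  set h := α m * (s ^ 2 * e₀ + xbar * e₁) + β m * (xbar * e₀ + e₁) with hh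
  set q := xbar * e₀ + e₁ with hq
  have h5 : c 0 = α m * h := by rw [← h3, hh, hq]; ring
  have h6 : c 1 = β m * h + q := by rw [← h4, hh, hq]; ring
  have h7 : ∑ j, γ m j * (u j - u m) = h ^ 2 + q ^ 2 := by
    rw [h2, h5, h6, hh, hq]; ring
  rw [h7] at h1
  have hh0 : h = 0 := by nlinarith [sq_nonneg h, sq_nonneg q]
  have hq0 : q = 0 := by nlinarith [sq_nonneg h, sq_nonneg q]
  ext k
  fin_cases k
  · simp [h5, hh0]
  · simp [h6, hh0, hq0]

/-! ### Spectrum of `BBar` -/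

/-- The estimate at a single node behind the stability of `BBar`. -/
theorem node_estimate {κ α β xbar d ε : ℝ} (hκ : 0 < κ) (hd : 0 ≤ d)  (hε : 0 ≤ ε)
    (hsmall : d * ε * (2 * α ^ 2 * κ + 2 * (α * xbar + β) ^ 2 + 1) ≤ 1 / 2)
    {e q a b h z : ℂ} (hz : z ≠ 0) (hz2 : 0 ≤ 2 * z.re + ε * Complex.normSq z)
    (hh : h = α * (κ * e + xbar * q) + β * q) (ha : z * a = α * h) (hb : z * b = β * h + q) :
    d ^ 2 * (κ * Complex.normSq a + Complex.normSq (xbar * a + b)) +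
        1 / 2 * (κ * Complex.normSq e + Complex.normSq q) ≤
      κ * Complex.normSq (e + d * a) + Complex.normSq (q + d * (xbar * a + b)) := by
  set N := Complex.normSq
  have hzpos : 0 < N z := Complex.normSq_pos.2 hz
  -- The inner product ⟨e, v⟩ for R of the disagreement and the eigenvector v = (a, b) at the node;
  -- κ|e|² + |q|² is the corresponding squared norm. Since z v = C (h, q) and (h, q) = C' R e, the
  -- product `z * X` is real and nonnegative.
  set X : ℂ := κ * (starRingEnd ℂ e) * a + starRingEnd ℂ q * (xbar * a + b) with hX
  have hzX : z * X = ((N h + N q : ℝ) : ℂ) := by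
    have h1 : z * X = (κ * starRingEnd ℂ e + xbar * starRingEnd ℂ q) * (z * a) +
        starRingEnd ℂ q * (z * b) := by rw [hX]; ring
    rw [h1, ha, hb, Complex.ofReal_add, Complex.normSq_eq_conj_mul_self,
      Complex.normSq_eq_conj_mul_self, hh]
    simp only [map_add, map_mul, Complex.conj_ofReal]
    ring
  have hXre : N z * X.re = (N h + N q) * z.re := by
    have h1 : starRingEnd ℂ z * (z * X) = (N z : ℂ) * X := by
      rw [Complex.normSq_eq_conj_mul_self]; ring
    rw [hzX] at h1
    have h2 := congrArg Complex.re h1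
    rw [Complex.re_ofReal_mul, Complex.mul_re, Complex.ofReal_re, Complex.ofReal_im,
      Complex.conj_re] at h2
    linarith
  have hexp : κ * N (e + d * a) + N (q + d * (xbar * a + b)) =
      κ * N e + N q + 2 * d * X.re + d ^ 2 * (κ * N a + N (xbar * a + b)) := by
    simp only [N, hX, Complex.normSq_apply, Complex.add_re, Complex.add_im, Complex.mul_re,
      Complex.mul_im, Complex.ofReal_re, Complex.ofReal_im, Complex.conj_re, Complex.conj_im]
    ring
  have hk : N h + N q ≤ (2 * α ^ 2 * κ + 2 * (α * xbar + β) ^ 2 + 1) * (κ * N e + N q) := by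
    have h1 : h = ((α * κ : ℝ) : ℂ) * e + ((α * xbar + β : ℝ) : ℂ) * q := by
      rw [hh]; push_cast; ring
    have h2 : N h ≤ 2 * ((α * κ) ^ 2 * N e) + 2 * ((α * xbar + β) ^ 2 * N q) := by
      have h3 : 2 * ((α * κ) ^ 2 * N e) + 2 * ((α * xbar + β) ^ 2 * N q) - N h =
          N (((α * κ : ℝ) : ℂ) * e - ((α * xbar + β : ℝ) : ℂ) * q) := by
        rw [h1]
        simp only [N, Complex.normSq_apply, Complex.add_re, Complex.add_im, Complex.mul_re,
          Complex.mul_im, Complex.ofReal_re, Complex.ofReal_im, Complex.sub_re, Complex.sub_im]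
        ring
      have := Complex.normSq_nonneg (((α * κ : ℝ) : ℂ) * e - ((α * xbar + β : ℝ) : ℂ) * q)
      rw [← h3] at this
      linarith
    have h4 : 0 ≤ N e := Complex.normSq_nonneg e
    have h5 : 0 ≤ N q := Complex.normSq_nonneg q
    have h6 : 0 ≤ κ * N e := by positivity
    have h7 : 0 ≤ α ^ 2 * κ * N q := by positivity
    have h8 : 0 ≤ (α * xbar + β) ^ 2 * (κ * N e) := by positivity
    nlinarith
  -- Here Re X = (|h|² + |q|²) Re z / |z|², and `hz2` bounds Re z / |z|² below by -ε/2. The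
  -- smallness of `d * ε` lets half of the squared norm of the disagreement absorb the cross term.
  have hcross : -(1 / 2) * (κ * N e + N q) ≤ 2 * d * X.re := by
    have h1 : 0 ≤ N h + N q := add_nonneg (Complex.normSq_nonneg _) (Complex.normSq_nonneg _)
    have h2 : 0 ≤ N z * (2 * d * X.re + d * ε * (N h + N q)) := by
      have : N z * (2 * d * X.re + d * ε * (N h + N q)) =
          d * (N h + N q) * (2 * z.re + ε * N z) := by
        linear_combination 2 * d * hXre
      rw [this]
      positivity
    have h3 : 0 ≤ 2 * d * X.re + d * ε * (N h + N q) := nonneg_of_mul_nonneg_right h2 hzpos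
    have h4 : 0 ≤ κ * N e + N q :=
      add_nonneg (mul_nonneg hκ.le (Complex.normSq_nonneg _)) (Complex.normSq_nonneg _)
    have h5 : d * ε * (N h + N q) ≤ 1 / 2 * (κ * N e + N q) :=
      (mul_le_mul_of_nonneg_left hk (mul_nonneg hd hε)).trans (by
        rw [← mul_assoc]; exact mul_le_mul_of_nonneg_right hsmall h4)
    linarith
  rw [hexp]
  linarith

/-- Weighted Cauchy–Schwarz; with a row of `γ` as weights it bounds the combined neighbour values by
their maximal norm. -/
theorem normSq_sum_smul_le {n : ℕ} {w : Fin n → ℝ} (hw : ∀ j, 0 ≤ w j) (f : Fin n → ℂ) :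
    Complex.normSq (∑ j, w j • f j) ≤ (∑ j, w j) * ∑ j, w j * Complex.normSq (f j) := by
  have h1 : ‖∑ j, w j • f j‖ ≤ ∑ j, w j * ‖f j‖ :=
    (norm_sum_le _ _).trans (Finset.sum_le_sum fun j _ => by
      rw [norm_smul, Real.norm_of_nonneg (hw j)])
  have h2 := Finset.sum_sq_le_sum_mul_sum_of_sq_le_mul Finset.univ (r := fun j => w j * ‖f j‖)
    (f := w) (g := fun j => w j * Complex.normSq (f j)) (fun j _ => hw j)
    (fun j _ => mul_nonneg (hw j) (Complex.normSq_nonneg _))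
    (fun j _ => by rw [Complex.normSq_eq_norm_sq]; exact le_of_eq (by ring))
  rw [Complex.normSq_eq_norm_sq]
  exact (pow_le_pow_left₀ (norm_nonneg _) h1 2).trans h2

/-- For small `ε`, the map `1 + ε BBar` has no eigenvalue outside the open unit disc other
than one. -/
theorem exists_BBar_eigenvector_eq_zero {n : ℕ} (hn : 0 < n) {γ : Fin n → Fin n → ℝ}
    (hγ : ∀ i j, 0 ≤ γ i j) (α β : Fin n → ℝ) {xbar s : ℝ} (hvar : 0 < s ^ 2 - xbar ^ 2) :
    ∃ ε : ℝ, 0 < ε ∧ ∀ (z : ℂ) (v : Fin n × Fin 2 → ℂ), z ≠ 0 →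
      0 ≤ 2 * z.re + ε * Complex.normSq z →
      (BBar γ α β xbar s).map (fun r => (r : ℂ)) *ᵥ v = z • v → v = 0 := by
  set κ := s ^ 2 - xbar ^ 2 with hκ
  let d : Fin n → ℝ := fun i => ∑ j, γ i j
  let C : Fin n → ℝ := fun i => 2 * α i ^ 2 * κ + 2 * (α i * xbar + β i) ^ 2 + 1
  have hd : ∀ i, 0 ≤ d i := fun i => Finset.sum_nonneg fun j _ => hγ i j
  have hC : ∀ i, 0 ≤ C i := fun i => by positivity
  have hS : 0 ≤ ∑ i, d i * C i := Finset.sum_nonneg fun i _ => mul_nonneg (hd i) (hC i)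
  -- Small enough for `node_estimate` at all nodes at once; the added 1 keeps the denominator
  -- positive.
  set ε : ℝ := 1 / (2 * (∑ i, d i * C i + 1)) with hεdef
  have hε : 0 < ε := by positivity
  have hsmall : ∀ i, d i * ε * C i ≤ 1 / 2 := fun i => by
    have h1 : d i * C i ≤ ∑ i, d i * C i :=
      Finset.single_le_sum (f := fun i => d i * C i) (fun i _ => mul_nonneg (hd i) (hC i))
        (Finset.mem_univ i)
    have h2 : d i * ε * C i = (d i * C i) / (2 * (∑ i, d i * C i + 1)) := by
      rw [hεdef]; ring
    rw [h2, div_le_div_iff₀ (by positivity) (by norm_num)]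
    linarith
  -- For ε > 0, `hz2` says |1 + εz| ≥ 1.
  refine ⟨ε, hε, fun z v hz hz2 hv => ?_⟩
  -- The squared norm of v_i for R. At a node maximizing it, ∑ γ_mj v_j = d v_m + e has squared norm
  -- at most d² N m by maximality and at least d² N m + |e|²/2 by `node_estimate`, so e = 0.
  let N : Fin n → ℝ := fun i =>
    κ * Complex.normSq (v (i, 0)) + Complex.normSq (xbar * v (i, 0) + v (i, 1))
  obtain ⟨m, -, hm⟩ := Finset.exists_max_image Finset.univ N ⟨⟨0, hn⟩, Finset.mem_univ _⟩
  set e₀ := disagreement γ v m 0 with he₀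
  set e₁ := disagreement γ v m 1 with he₁
  have hsum : ∀ c, ∑ j, γ m j • v (j, c) = disagreement γ v m c + d m * v (m, c) := fun c => by
    simp only [disagreement, d, smul_sub, Finset.sum_sub_distrib, Complex.ofReal_sum,
      Finset.sum_mul, Complex.real_smul]
    ring
  have h0 := congrFun hv (m, 0)
  have h1 := congrFun hv (m, 1)
  rw [BBar_map_mulVec] at h0 h1
  simp only [phiBar, Matrix.of_apply, Matrix.cons_val', Matrix.cons_val_zero, Matrix.cons_val_one,
    Matrix.cons_val_fin_one, Pi.smul_apply, smul_eq_mul, ← he₀, ← he₁] at h0 h1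
  push_cast at h0 h1
  set q : ℂ := xbar * e₀ + e₁ with hq
  set h : ℂ := α m * (κ * e₀ + xbar * q) + β m * q with hh
  have ha : z * v (m, 0) = α m * h := by rw [← h0, hh, hq, hκ]; push_cast; ring
  have hb : z * v (m, 1) = β m * h + q := by rw [← h1, hh, hq, hκ]; push_cast; ring
  have key := node_estimate hvar (hd m) hε.le (hsmall m) hz hz2 hh ha hb
  have hy0 := normSq_sum_smul_le (hγ m) (fun j => v (j, 0))
  have hy1 := normSq_sum_smul_le (hγ m) (fun j => xbar * v (j, 0) + v (j, 1))
  have e1 : ∑ j, γ m j • (xbar * v (j, 0) + v (j, 1)) = q + d m * (xbar * v (m, 0) + v (m, 1)) := by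
    have : ∑ j, γ m j • (xbar * v (j, 0) + v (j, 1)) =
        xbar * ∑ j, γ m j • v (j, 0) + ∑ j, γ m j • v (j, 1) := by
      rw [Finset.mul_sum, ← Finset.sum_add_distrib]
      exact Finset.sum_congr rfl fun j _ => by simp only [Complex.real_smul]; ring
    rw [this, hsum, hsum, hq]
    ring
  rw [hsum] at hy0
  rw [e1] at hy1
  have hle : κ * (d m * ∑ j, γ m j * Complex.normSq (v (j, 0))) +
      d m * ∑ j, γ m j * Complex.normSq (xbar * v (j, 0) + v (j, 1)) ≤ d m ^ 2 * N m := by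
    have h2 : κ * (d m * ∑ j, γ m j * Complex.normSq (v (j, 0))) +
        d m * ∑ j, γ m j * Complex.normSq (xbar * v (j, 0) + v (j, 1)) =
        d m * ∑ j, γ m j * N j := by
      simp only [N, mul_add, Finset.sum_add_distrib, Finset.mul_sum]
      congr 1
      exact Finset.sum_congr rfl fun j _ => by ring
    have h3 : ∑ j, γ m j * N j ≤ d m * N m := by
      simp only [d, Finset.sum_mul]
      exact Finset.sum_le_sum fun j hj => mul_le_mul_of_nonneg_left (hm j hj) (hγ m j)
    rw [h2, pow_two, mul_assoc]
    exact mul_le_mul_of_nonneg_left h3 (hd m)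
  have hfin : κ * Complex.normSq e₀ + Complex.normSq q ≤ 0 := by
    have h4 := mul_le_mul_of_nonneg_left hy0 hvar.le
    change d m ^ 2 * N m + _ ≤ _ at key
    linarith
  have hq0 : q = 0 := Complex.normSq_eq_zero.1 (le_antisymm (by
    have := mul_nonneg hvar.le (Complex.normSq_nonneg e₀); linarith) (Complex.normSq_nonneg q))
  have he0 : e₀ = 0 := by
    rw [hq0, map_zero, add_zero] at hfin
    have := Complex.normSq_nonneg e₀
    exact Complex.normSq_eq_zero.1 (le_antisymm (by nlinarith) this)
  have hh0 : h = 0 := by rw [hh, hq0, he0]; ring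
  rw [hh0, mul_zero] at ha hb
  rw [hq0, add_zero] at hb
  have hv0 := (mul_eq_zero.1 ha).resolve_left hz
  have hv1 := (mul_eq_zero.1 hb).resolve_left hz
  have hNm : N m = 0 := by simp [N, hv0, hv1]
  ext ⟨i, c⟩
  have hNi := hm i (Finset.mem_univ i)
  rw [hNm] at hNi
  have k1 := mul_nonneg hvar.le (Complex.normSq_nonneg (v (i, 0)))
  have k2 := Complex.normSq_nonneg (xbar * v (i, 0) + v (i, 1))
  have k3 : κ * Complex.normSq (v (i, 0)) = 0 := le_antisymm (by simp only [N] at hNi; linarith) k1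
  have k4 : v (i, 0) = 0 := Complex.normSq_eq_zero.1 ((mul_eq_zero.1 k3).resolve_left hvar.ne')
  have k5 : xbar * v (i, 0) + v (i, 1) = 0 :=
    Complex.normSq_eq_zero.1 (le_antisymm (by simp only [N] at hNi; linarith) k2)
  rw [k4, mul_zero, zero_add] at k5
  fin_cases c
  · exact k4
  · exact k5

/-! ### Left null vectors and the consensus projection -/

/-- A linear functional given by the dot product with a vector. -/
theorem exists_dotProduct_eq {ι : Type*} [Fintype ι] [DecidableEq ι] (f : (ι → ℝ) →ₗ[ℝ] ℝ) :
    ∃ p : ι → ℝ, ∀ v, p ⬝ᵥ v = f v :=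
  ⟨fun i => f (Pi.single i 1), fun v => by
    conv_rhs => rw [← Finset.univ_sum_single v, map_sum]
    refine Finset.sum_congr rfl fun i _ => ?_
    have : (Pi.single i (v i) : ι → ℝ) = v i • Pi.single i 1 := by
      rw [← Pi.single_smul, smul_eq_mul, mul_one]
    rw [this, map_smul, smul_eq_mul, mul_comm]⟩

/-- If `a` is in no translate of the range of `B` by multiples of `b`, there is a left null vector
of `B` with prescribed values at `a` and `b`. -/
theorem exists_left_null_vector {ι : Type*} [Fintype ι] [DecidableEq ι] (B : Matrix ι ι ℝ)
    (a b : ι → ℝ) (hab : ∀ (v : ι → ℝ) (t : ℝ), B *ᵥ v ≠ a + t • b) :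
    ∃ p : ι → ℝ, p ᵥ* B = 0 ∧ p ⬝ᵥ a = 1 ∧ p ⬝ᵥ b = 0 := by
  have ha : a ∉ LinearMap.range B.mulVecLin ⊔ Submodule.span ℝ {b} := by
    intro h
    obtain ⟨y, ⟨v, rfl⟩, w, hw, hyw⟩ := Submodule.mem_sup.1 h
    obtain ⟨t, rfl⟩ := Submodule.mem_span_singleton.1 hw
    refine hab v (-t) ?_
    rw [← hyw, neg_smul, add_neg_cancel_right]
    rfl
  obtain ⟨f, hf, hle⟩ := Submodule.exists_le_ker_of_notMem ha
  obtain ⟨p, hp⟩ := exists_dotProduct_eq ((f a)⁻¹ • f)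
  refine ⟨p, ?_, ?_, ?_⟩
  · refine dotProduct_eq _ _ fun v => ?_
    rw [← Matrix.dotProduct_mulVec, hp, LinearMap.smul_apply, zero_dotProduct,
      ← Matrix.mulVecLin_apply,
      LinearMap.mem_ker.1 (hle (Submodule.mem_sup_left (LinearMap.mem_range_self B.mulVecLin v))),
      smul_zero]
  · rw [hp, LinearMap.smul_apply, smul_eq_mul, inv_mul_cancel₀ hf]
  · rw [hp, LinearMap.smul_apply,
      LinearMap.mem_ker.1 (hle (Submodule.mem_sup_right (Submodule.mem_span_singleton_self b))),
      smul_zero]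

/-- A left null vector that vanishes on the kernel vanishes, if kernel and range are disjoint. -/
theorem left_null_vector_eq_zero {ι : Type*} [Fintype ι] [DecidableEq ι] (B : Matrix ι ι ℝ)
    (hdisj : ∀ v, B *ᵥ (B *ᵥ v) = 0 → B *ᵥ v = 0) {p : ι → ℝ} (hp : p ᵥ* B = 0)
    (hker : ∀ v, B *ᵥ v = 0 → p ⬝ᵥ v = 0) : p = 0 := by
  have hd : Disjoint (LinearMap.ker B.mulVecLin) (LinearMap.range B.mulVecLin) := by
    rw [Submodule.disjoint_def]
    rintro _ hx ⟨v, rfl⟩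
    exact hdisj v (LinearMap.mem_ker.1 hx)
  have htop := Submodule.eq_top_of_disjoint _ _
    (by rw [add_comm, LinearMap.finrank_range_add_finrank_ker]) hd
  refine dotProduct_eq _ _ fun v => ?_
  obtain ⟨y, hy, _, ⟨w, rfl⟩, rfl⟩ := Submodule.mem_sup.1 (htop ▸ Submodule.mem_top (x := v))
  rw [dotProduct_add, hker y (LinearMap.mem_ker.1 hy), zero_dotProduct, Matrix.mulVecLin_apply,
    Matrix.dotProduct_mulVec, hp, zero_dotProduct, add_zero]

theorem weight_nonneg {n : ℕ} {G : Digraph (Fin n)} {γ : Fin n → Fin n → ℝ}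
    (hγpos : ∀ i j, G.Adj j i → 0 < γ i j) (hγzero : ∀ i j, ¬ G.Adj j i → γ i j = 0)
    (i j : Fin n) : 0 ≤ γ i j := by
  by_cases h : G.Adj j i
  · exact (hγpos i j h).le
  · exact (hγzero i j h).ge

theorem exists_root {V : Type*} {G : Digraph V} (hG : HasSpanningTree G) :
    ∃ r, ∀ v, Relation.ReflTransGen G.Adj r v := by
  obtain ⟨r, T, hT⟩ := hG
  exact ⟨r, fun v => Relation.ReflTransGen.mono (p := G.Adj) (fun _ _ h => hT.le h) r v (hT.reach v)⟩

theorem consensus_apply {n : ℕ} (a b : ℝ) (p : Fin n × Fin 2) :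
    (a • vecI1 n + b • vecI2 n) p = ![a, b] p.2 := by
  obtain ⟨i, c⟩ := p
  fin_cases c <;> simp [vecI1, vecI2]

section

variable {n : ℕ} {G : Digraph (Fin n)} {γ : Fin n → Fin n → ℝ}

theorem eq_consensus_of_BBar_mulVec_eq_zero
    (hγpos : ∀ i j, G.Adj j i → 0 < γ i j) (hγ : ∀ i j, 0 ≤ γ i j) {r : Fin n}
    (hr : ∀ v, Relation.ReflTransGen G.Adj r v) {α β : Fin n → ℝ} (hα : ∀ i, α i ≠ 0)
    {xbar s : ℝ} (hvar : 0 < s ^ 2 - xbar ^ 2) {v : Fin n × Fin 2 → ℝ}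
    (hv : BBar γ α β xbar s *ᵥ v = 0) : v = v (r, 0) • vecI1 n + v (r, 1) • vecI2 n := by
  ext ⟨i, c⟩
  rw [consensus_apply, eq_root_of_BBar_mulVec_eq_zero hγpos hγ hr hα hvar hv i c]
  fin_cases c <;> rfl

theorem BBar_mulVec_consensus (γ : Fin n → Fin n → ℝ) (α β : Fin n → ℝ) (xbar s a b : ℝ) :
    BBar γ α β xbar s *ᵥ (a • vecI1 n + b • vecI2 n) = 0 :=
  BBar_mulVec_of_consensus γ α β xbar s fun i j c => by
    rw [consensus_apply, consensus_apply]

/-- Existence: the range of `BBar` contains no nonzero consensus vector, so a functional can vanish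
on the range and take prescribed values on consensus. Uniqueness: kernel and range are
complementary, so a left null vector is determined by its values at `vecI1` and `vecI2`. -/
theorem existsUnique_normalizedLeftPair
    (hγpos : ∀ i j, G.Adj j i → 0 < γ i j) (hγ : ∀ i j, 0 ≤ γ i j) {r : Fin n}
    (hr : ∀ v, Relation.ReflTransGen G.Adj r v) {α β : Fin n → ℝ} (hα : ∀ i, α i ≠ 0)
    {xbar s : ℝ} (hvar : 0 < s ^ 2 - xbar ^ 2) :
    ∃! p : (Fin n × Fin 2 → ℝ) × (Fin n × Fin 2 → ℝ),
      IsNormalizedLeftPair (BBar γ α β xbar s) p.1 p.2 := by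
  have hn : 0 < n := r.pos
  have hrange : ∀ (v : Fin n × Fin 2 → ℝ) (a b : ℝ),
      BBar γ α β xbar s *ᵥ v = a • vecI1 n + b • vecI2 n → a = 0 ∧ b = 0 := by
    intro v a b h
    have := eq_zero_of_BBar_mulVec_eq_consensus hn hγ (c := ![a, b]) (fun i k => by
      rw [h, consensus_apply])
    exact ⟨congrFun this 0, congrFun this 1⟩
  obtain ⟨p₁, h1, h11, h12⟩ := exists_left_null_vector (BBar γ α β xbar s) (vecI1 n) (vecI2 n)
    (fun v t h => one_ne_zero (hrange v 1 t (by rw [h, one_smul])).1)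
  obtain ⟨p₂, h2, h22, h21⟩ := exists_left_null_vector (BBar γ α β xbar s) (vecI2 n) (vecI1 n)
    (fun v t h => one_ne_zero (hrange v t 1 (by rw [h, one_smul, add_comm])).2)
  have huniq : ∀ p p' : Fin n × Fin 2 → ℝ, p ᵥ* BBar γ α β xbar s = 0 →
      p' ᵥ* BBar γ α β xbar s = 0 → p ⬝ᵥ vecI1 n = p' ⬝ᵥ vecI1 n →
      p ⬝ᵥ vecI2 n = p' ⬝ᵥ vecI2 n → p = p' := by
    intro p p' hp hp' k1 k2
    refine sub_eq_zero.1 (left_null_vector_eq_zero (BBar γ α β xbar s) (fun v hv => ?_)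
      (by rw [Matrix.sub_vecMul, hp, hp', sub_zero]) fun v hv => ?_)
    · have h := eq_consensus_of_BBar_mulVec_eq_zero hγpos hγ hr hα hvar hv
      obtain ⟨k3, k4⟩ := hrange v _ _ h
      rw [h, k3, k4, zero_smul, zero_smul, add_zero]
    · rw [eq_consensus_of_BBar_mulVec_eq_zero hγpos hγ hr hα hvar hv, dotProduct_add,
        dotProduct_smul, dotProduct_smul, sub_dotProduct, sub_dotProduct, k1, k2]
      simp
  refine ⟨(p₁, p₂), ⟨h1, h2, h11, h12, h21, h22⟩, ?_⟩
  rintro ⟨q₁, q₂⟩ ⟨k1, k2, k11, k12, k21, k22⟩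
  exact Prod.ext (huniq _ _ k1 h1 (k11.trans h11.symm) (k12.trans h12.symm))
    (huniq _ _ k2 h2 (k21.trans h21.symm) (k22.trans h22.symm))

/-- The projection onto the consensus vectors given by a normalized pair of left eigenvectors. -/
def consensusProj (p₁ p₂ : Fin n × Fin 2 → ℝ) : Matrix (Fin n × Fin 2) (Fin n × Fin 2) ℝ :=
  Matrix.vecMulVec (vecI1 n) p₁ + Matrix.vecMulVec (vecI2 n) p₂

theorem consensusProj_mulVec (p₁ p₂ v : Fin n × Fin 2 → ℝ) :
    consensusProj p₁ p₂ *ᵥ v = (p₁ ⬝ᵥ v) • vecI1 n + (p₂ ⬝ᵥ v) • vecI2 n := by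
  rw [consensusProj, Matrix.add_mulVec, Matrix.vecMulVec_mulVec, Matrix.vecMulVec_mulVec]
  simp

theorem consensusProj_mul {B : Matrix (Fin n × Fin 2) (Fin n × Fin 2) ℝ}
    {p₁ p₂ : Fin n × Fin 2 → ℝ} (hp : IsNormalizedLeftPair B p₁ p₂) :
    consensusProj p₁ p₂ * B = 0 := by
  rw [consensusProj, add_mul, Matrix.vecMulVec_mul, Matrix.vecMulVec_mul, hp.left₁, hp.left₂]
  simp

theorem consensusProj_mul_self {B : Matrix (Fin n × Fin 2) (Fin n × Fin 2) ℝ}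
    {p₁ p₂ : Fin n × Fin 2 → ℝ} (hp : IsNormalizedLeftPair B p₁ p₂) :
    consensusProj p₁ p₂ * consensusProj p₁ p₂ = consensusProj p₁ p₂ := by
  refine Matrix.ext_of_mulVec_single fun i => ?_
  rw [← Matrix.mulVec_mulVec, consensusProj_mulVec, consensusProj_mulVec]
  simp only [dotProduct_add, dotProduct_smul, hp.norm₁₁, hp.norm₁₂, hp.norm₂₁, hp.norm₂₂]
  simp

theorem mul_consensusProj (γ : Fin n → Fin n → ℝ) (α β : Fin n → ℝ) (xbar s : ℝ)
    (p₁ p₂ : Fin n × Fin 2 → ℝ) : BBar γ α β xbar s * consensusProj p₁ p₂ = 0 := by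
  refine Matrix.ext_of_mulVec_single fun i => ?_
  rw [← Matrix.mulVec_mulVec, consensusProj_mulVec, BBar_mulVec_consensus, Matrix.zero_mulVec]

/-- Let T v = z v with |z| ≥ 1. Since P T = 0, also P v = 0, so v is an eigenvector of B̄ for λ = (z
- 1)/ε, and |1 + ελ| = |z| ≥ 1. If λ ≠ 0, the spectral lemma gives v = 0; if λ = 0, v is a consensus
vector killed by P, again zero. -/
theorem exists_tendsto_pow_zero
    (hγpos : ∀ i j, G.Adj j i → 0 < γ i j) (hγ : ∀ i j, 0 ≤ γ i j) {r : Fin n}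
    (hr : ∀ v, Relation.ReflTransGen G.Adj r v) {α β : Fin n → ℝ} (hα : ∀ i, α i ≠ 0)
    {xbar s : ℝ} (hvar : 0 < s ^ 2 - xbar ^ 2) {p₁ p₂ : Fin n × Fin 2 → ℝ}
    (hp : IsNormalizedLeftPair (BBar γ α β xbar s) p₁ p₂) :
    ∃ ε : ℝ, 0 < ε ∧ ∀ p q, Tendsto (fun k => ((1 + ε • BBar γ α β xbar s - consensusProj p₁ p₂ :
      Matrix (Fin n × Fin 2) (Fin n × Fin 2) ℝ) ^ k) p q) atTop (𝓝 0) := by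
  obtain ⟨ε, hε, hev⟩ := exists_BBar_eigenvector_eq_zero r.pos hγ α β hvar
  have : Nonempty (Fin n × Fin 2) := ⟨(r, 0)⟩
  refine ⟨ε, hε, tendsto_matrix_pow_zero _ fun z v hv hz => ?_⟩
  by_contra hz1
  rw [not_lt] at hz1
  refine hv ?_
  set B := BBar γ α β xbar s with hB
  set P := consensusProj p₁ p₂ with hP
  let toC : Matrix (Fin n × Fin 2) (Fin n × Fin 2) ℝ →+* Matrix (Fin n × Fin 2) (Fin n × Fin 2) ℂ :=
    Complex.ofRealHom.mapMatrix
  have hz' : toC (1 + ε • B - P) *ᵥ v = z • v := hz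
  have hsmul : toC (ε • B) = (ε : ℂ) • toC B := by
    ext p q
    simp [toC, Matrix.map_apply]
  rw [map_sub, map_add, map_one, hsmul] at hz'
  have hz0 : z ≠ 0 := by rintro rfl; norm_num at hz1
  have hPv : toC P *ᵥ v = 0 := by
    have h1 : toC P *ᵥ ((1 + (ε : ℂ) • toC B - toC P) *ᵥ v) = 0 := by
      rw [Matrix.mulVec_mulVec, mul_sub, mul_add, mul_one, Matrix.mul_smul, ← map_mul, ← map_mul,
        consensusProj_mul hp, consensusProj_mul_self hp]
      simp [← hP]
    rw [hz', Matrix.mulVec_smul] at h1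
    exact (smul_eq_zero.1 h1).resolve_left hz0
  have hBv : (ε : ℂ) • toC B *ᵥ v = (z - 1) • v := by
    rw [Matrix.sub_mulVec, hPv, Matrix.add_mulVec, Matrix.one_mulVec, sub_zero,
      Matrix.smul_mulVec] at hz'
    rw [sub_smul, one_smul, ← hz', add_sub_cancel_left]
  have hεC : (ε : ℂ) ≠ 0 := by exact_mod_cast hε.ne'
  have hBv' : toC B *ᵥ v = ((z - 1) / ε) • v := by
    rw [div_eq_inv_mul, mul_smul, ← hBv, smul_smul, inv_mul_cancel₀ hεC, one_smul]
  by_cases hz2 : z = 1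
  · rw [hz2, sub_self, zero_div, zero_smul] at hBv'
    have hre : B *ᵥ (fun p => (v p).re) = 0 := by
      ext p
      have := congrArg Complex.re (congrFun hBv' p)
      simpa [toC, Matrix.mulVec, dotProduct] using this
    have him : B *ᵥ (fun p => (v p).im) = 0 := by
      ext p
      have := congrArg Complex.im (congrFun hBv' p)
      simpa [toC, Matrix.mulVec, dotProduct] using this
    have hPre : P *ᵥ (fun p => (v p).re) = 0 := by
      ext p
      have := congrArg Complex.re (congrFun hPv p)
      simpa [toC, Matrix.mulVec, dotProduct] using this
    have hPim : P *ᵥ (fun p => (v p).im) = 0 := by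
      ext p
      have := congrArg Complex.im (congrFun hPv p)
      simpa [toC, Matrix.mulVec, dotProduct] using this
    have hfix : ∀ w : Fin n × Fin 2 → ℝ, B *ᵥ w = 0 → P *ᵥ w = 0 → w = 0 := by
      intro w hw hPw
      have h := eq_consensus_of_BBar_mulVec_eq_zero hγpos hγ hr hα hvar hw
      rw [hP, consensusProj_mulVec] at hPw
      have e1 : p₁ ⬝ᵥ w = w (r, 0) := by
        conv_lhs => rw [h]
        simp [dotProduct_add, dotProduct_smul, hp.norm₁₁, hp.norm₁₂]
      have e2 : p₂ ⬝ᵥ w = w (r, 1) := by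
        conv_lhs => rw [h]
        simp [dotProduct_add, dotProduct_smul, hp.norm₂₁, hp.norm₂₂]
      rw [e1, e2, ← h] at hPw
      exact hPw
    ext p
    exact Complex.ext (congrFun (hfix _ hre hPre) p) (congrFun (hfix _ him hPim) p)
  · have hl : (z - 1) / ε ≠ 0 := div_ne_zero (sub_ne_zero.2 hz2) hεC
    refine hev _ v hl ?_ hBv'
    have hzn : 1 ≤ Complex.normSq z := by
      rw [Complex.normSq_eq_norm_sq]
      exact one_le_pow₀ hz1
    rw [Complex.normSq_div, Complex.normSq_ofReal, Complex.div_ofReal_re]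
    rw [Complex.normSq_apply] at hzn ⊢
    simp only [Complex.sub_re, Complex.sub_im, Complex.one_re, Complex.one_im]
    have : 2 * ((z.re - 1) / ε) + ε * (((z.re - 1) * (z.re - 1) + (z.im - 0) * (z.im - 0)) /
        (ε * ε)) = (z.re * z.re + z.im * z.im - 1) / ε := by
      field_simp
      ring
    rw [this]
    exact div_nonneg (by linarith) hε.le

end

/-! ### Deterministic recursions -/

/-- A nonnegative sequence with `v (t+1) ≤ (1 - c δ t) v t + δ t e t` tends to zero if `e` does and
`δ` is not summable. -/
theorem tendsto_zero_of_recursive_le {v δ e : ℕ → ℝ} {c : ℝ} (hc : 0 < c) (hv : ∀ t, 0 ≤ v t)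
    (hδ : ∀ t, 0 < δ t) (hδ0 : Tendsto δ atTop (𝓝 0))
    (hsum : Tendsto (fun N => ∑ t ∈ Finset.range N, δ t) atTop atTop)
    (he : Tendsto e atTop (𝓝 0))
    (hrec : ∀ᶠ t in atTop, v (t + 1) ≤ (1 - c * δ t) * v t + δ t * e t) :
    Tendsto v atTop (𝓝 0) := by
  rw [Metric.tendsto_atTop]
  intro η hη
  obtain ⟨T, hT⟩ := eventually_atTop.1 ((hrec.and
    (he.eventually_lt_const (show 0 < c * (η / 2) by positivity))).and
    (hδ0.eventually_lt_const (show 0 < 1 / c by positivity)))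
  -- Since `e t < c * (η / 2)` from time `T` on, subtracting `η / 2` makes the recursion
  -- homogeneous. The condition δ < 1/c keeps the factors 1 - cδ positive, and their product is
  -- bounded by an exponential of -c∑δ.
  have hbound : ∀ k, v (T + k) - η / 2 ≤
      Real.exp (-c * (∑ t ∈ Finset.range (T + k), δ t - ∑ t ∈ Finset.range T, δ t)) * v T := by
    intro k
    induction k with
    | zero => simp; linarith
    | succ k ih =>
      obtain ⟨⟨h1, h2⟩, h3⟩ := hT (T + k) (by omega)
      have hd := hδ (T + k)
      have h4 : c * δ (T + k) < 1 := by rw [lt_div_iff₀ hc] at h3; linarith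
      have h5 : v (T + (k + 1)) - η / 2 ≤ (1 - c * δ (T + k)) * (v (T + k) - η / 2) := by
        rw [← add_assoc]
        nlinarith
      have h6 : (1 - c * δ (T + k)) ≤ Real.exp (-(c * δ (T + k))) := by
        have := Real.add_one_le_exp (-(c * δ (T + k)))
        linarith
      have h7 := mul_le_mul_of_nonneg_left ih (show 0 ≤ 1 - c * δ (T + k) by linarith)
      have h8 := mul_le_mul_of_nonneg_right h6 (mul_nonneg (Real.exp_nonneg
        (-c * (∑ t ∈ Finset.range (T + k), δ t - ∑ t ∈ Finset.range T, δ t))) (hv T))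
      rw [← mul_assoc (Real.exp _), ← Real.exp_add] at h8
      refine h5.trans (h7.trans (h8.trans (le_of_eq ?_)))
      rw [← add_assoc, Finset.sum_range_succ]
      congr 2
      ring
  have hlim : Tendsto (fun N => Real.exp (-c * (∑ t ∈ Finset.range N, δ t -
      ∑ t ∈ Finset.range T, δ t)) * v T) atTop (𝓝 0) := by
    have h1 : Tendsto (fun N => -c * (∑ t ∈ Finset.range N, δ t - ∑ t ∈ Finset.range T, δ t))
        atTop atBot :=
      (tendsto_atTop_add_const_right _ _ hsum).const_mul_atTop_of_neg (by linarith)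
    simpa using (Real.tendsto_exp_atBot.comp h1).mul_const (v T)
  obtain ⟨N, hN⟩ := eventually_atTop.1 (hlim.eventually_lt_const (half_pos hη))
  refine ⟨max N T, fun t ht => ?_⟩
  obtain ⟨k, rfl⟩ := Nat.exists_eq_add_of_le ((le_max_right N T).trans ht)
  have h1 := hbound k
  have h2 := hN (T + k) ((le_max_left N T).trans ht)
  rw [Real.dist_eq, sub_zero, abs_of_nonneg (hv _)]
  linarith

/-- A nonnegative sequence with `v (t+1) ≤ (1 + a t) v t` is bounded if `a` is summable. -/
theorem bounded_of_recursive_le {v a : ℕ → ℝ} (hv : ∀ t, 0 ≤ v t) (ha : ∀ t, 0 ≤ a t)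
    (hsum : Summable a) (hrec : ∀ᶠ t in atTop, v (t + 1) ≤ (1 + a t) * v t) :
    ∃ K, ∀ t, v t ≤ K := by
  obtain ⟨T, hT⟩ := eventually_atTop.1 hrec
  have hbound : ∀ k, v (T + k) ≤ Real.exp (∑ t ∈ Finset.range (T + k), a t) * v T := by
    intro k
    induction k with
    | zero =>
      refine le_mul_of_one_le_left (hv T) (Real.one_le_exp (Finset.sum_nonneg fun i _ => ha i))
    | succ k ih =>
      have h1 := hT (T + k) (by omega)
      have h2 : 1 + a (T + k) ≤ Real.exp (a (T + k)) := by
        linarith [Real.add_one_le_exp (a (T + k))]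
      rw [← add_assoc, Finset.sum_range_succ, add_comm (∑ t ∈ _, a t), Real.exp_add, mul_assoc]
      exact h1.trans (mul_le_mul h2 ih (hv _) (Real.exp_nonneg _))
  -- The first sum covers the times before the recursive inequality takes hold.
  refine ⟨∑ t ∈ Finset.range T, v t + Real.exp (∑' t, a t) * v T, fun t => ?_⟩
  have hpos : 0 ≤ Real.exp (∑' t, a t) * v T := mul_nonneg (Real.exp_nonneg _) (hv T)
  have hpos' : 0 ≤ ∑ t ∈ Finset.range T, v t := Finset.sum_nonneg fun i _ => hv i
  rcases lt_or_ge t T with h | h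
  · have := Finset.single_le_sum (f := v) (fun i _ => hv i) (Finset.mem_range.2 h)
    linarith
  · obtain ⟨k, rfl⟩ := Nat.exists_eq_add_of_le h
    have h1 := mul_le_mul_of_nonneg_right (Real.exp_le_exp.2
      (hsum.sum_le_tsum (Finset.range (T + k)) fun i _ => ha i)) (hv T)
    linarith [hbound k]

theorem tendsto_zero_of_dotProduct_self {ι : Type*} [Fintype ι] {u : ℕ → ι → ℝ}
    (h : Tendsto (fun t => u t ⬝ᵥ u t) atTop (𝓝 0)) : Tendsto u atTop (𝓝 0) := by
  rw [tendsto_pi_nhds]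
  intro i
  have h1 : Tendsto (fun t => u t i ^ 2) atTop (𝓝 0) :=
    squeeze_zero (fun t => sq_nonneg _) (fun t => by
      rw [pow_two]
      exact Finset.single_le_sum (f := fun i => u t i * u t i) (fun i _ => mul_self_nonneg _)
        (Finset.mem_univ i)) h
  have h2 := (Real.continuous_sqrt.tendsto 0).comp h1
  rw [Real.sqrt_zero] at h2
  refine (tendsto_zero_iff_abs_tendsto_zero _).2 (h2.congr fun t => ?_)
  simp [Real.sqrt_sq_eq_abs]

/-- A perturbed linear recursion `ρ (t+1) = (1 + δ t B) ρ t + (M (t+1) - M t)` converges if `M`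
does. -/
theorem tendsto_of_perturbed_recursion {ι κ : Type*} [Fintype ι] [DecidableEq ι] [Fintype κ]
    {B P : Matrix ι ι ℝ} {L : Matrix κ ι ℝ} {c C ε : ℝ} (hc : 0 < c) (hε : 0 < ε)
    (hPB : P * B = 0) (hPP : P * P = P) (hLP : L * P = 0)
    (hL : ∀ δ, 0 ≤ δ → δ ≤ ε → ∀ v, (L *ᵥ ((1 + δ • B) *ᵥ v)) ⬝ᵥ (L *ᵥ ((1 + δ • B) *ᵥ v)) ≤
        (1 - c * δ) * ((L *ᵥ v) ⬝ᵥ (L *ᵥ v)))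
    (hC : ∀ v, v ⬝ᵥ v ≤ C * ((L *ᵥ v) ⬝ᵥ (L *ᵥ v) + (P *ᵥ v) ⬝ᵥ (P *ᵥ v)))
    {δ : ℕ → ℝ} (hδ : ∀ t, 0 < δ t) (hδ0 : Tendsto δ atTop (𝓝 0))
    (hsum : Tendsto (fun N => ∑ t ∈ Finset.range N, δ t) atTop atTop)
    {ρ M : ℕ → ι → ℝ} {Minf : ι → ℝ} (hM0 : M 0 = 0) (hM : Tendsto M atTop (𝓝 Minf))
    (hrec : ∀ t, ρ (t + 1) = (1 + δ t • B) *ᵥ ρ t + (M (t + 1) - M t)) :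
    Tendsto ρ atTop (𝓝 (P *ᵥ (ρ 0 + Minf))) := by
  have hP : ∀ t, P *ᵥ ρ t = P *ᵥ (ρ 0 + M t) := by
    intro t
    induction t with
    | zero => rw [hM0, add_zero]
    | succ t ih =>
      rw [hrec, Matrix.mulVec_add, Matrix.mulVec_mulVec, mul_add, mul_one, Matrix.mul_smul, hPB,
        smul_zero, add_zero, ih, ← Matrix.mulVec_add]
      congr 1
      abel
  -- Adding the remaining noise `Minf - M t` trades the increments of `M`, which need not be small
  -- relative to δ, for the perturbation -δ B e with e → 0.
  set f : ℕ → ι → ℝ := fun t => ρ t + (Minf - M t) with hf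
  set e : ℕ → ι → ℝ := fun t => Minf - M t with he
  have he0 : Tendsto e atTop (𝓝 0) := by
    have := tendsto_const_nhds (x := Minf) |>.sub hM
    rwa [sub_self] at this
  have hfrec : ∀ t, f (t + 1) = (1 + δ t • B) *ᵥ f t + (-δ t) • (B *ᵥ e t) := by
    intro t
    simp only [hf, hrec, he, Matrix.mulVec_add, Matrix.add_mulVec, Matrix.one_mulVec,
      Matrix.smul_mulVec, neg_smul]
    abel
  set V : ℕ → ℝ := fun t => (L *ᵥ f t) ⬝ᵥ (L *ᵥ f t) with hV
  set E : ℕ → ℝ := fun t => (L *ᵥ (B *ᵥ e t)) ⬝ᵥ (L *ᵥ (B *ᵥ e t)) with hE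
  have hE0 : Tendsto E atTop (𝓝 0) := by
    have hcont : Continuous fun x : ι → ℝ => (L *ᵥ (B *ᵥ x)) ⬝ᵥ (L *ᵥ (B *ᵥ x)) := by
      fun_prop
    have := (hcont.tendsto 0).comp he0
    simp only [Matrix.mulVec_zero, dotProduct_zero] at this
    exact this
  have hV0 : Tendsto V atTop (𝓝 0) := by
    -- Young's inequality with parameter cδ/2 halves the contraction rate and costs (1 + 2/(cδ)) δ²
    -- E = (δ² + 2δ/c) E ≤ δ (ε + 2/c) E.
    have hE1 : Tendsto (fun t => (ε + 2 / c) * E t) atTop (𝓝 0) := by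
      simpa using hE0.const_mul (ε + 2 / c)
    refine tendsto_zero_of_recursive_le (half_pos hc) (fun t => dotProduct_self_nonneg_real _) hδ hδ0
      hsum hE1 ?_
    filter_upwards [hδ0.eventually_lt_const hε] with t ht
    have hd := hδ t
    have h1 := dotProduct_self_add_le (L *ᵥ ((1 + δ t • B) *ᵥ f t)) ((-δ t) • (L *ᵥ (B *ᵥ e t)))
      (show 0 < c / 2 * δ t by positivity)
    have h2 : V (t + 1) = (L *ᵥ ((1 + δ t • B) *ᵥ f t) + (-δ t) • (L *ᵥ (B *ᵥ e t))) ⬝ᵥ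
        (L *ᵥ ((1 + δ t • B) *ᵥ f t) + (-δ t) • (L *ᵥ (B *ᵥ e t))) := by
      simp only [hV]
      rw [hfrec, Matrix.mulVec_add, Matrix.mulVec_smul]
    have h3 := hL (δ t) hd.le ht.le (f t)
    have h4 : ((-δ t) • (L *ᵥ (B *ᵥ e t))) ⬝ᵥ ((-δ t) • (L *ᵥ (B *ᵥ e t))) = δ t ^ 2 * E t := by
      simp only [hE, smul_dotProduct, dotProduct_smul, smul_eq_mul]
      ring
    rw [← h2, h4] at h1
    have h5 : (1 + c / 2 * δ t) * ((L *ᵥ ((1 + δ t • B) *ᵥ f t)) ⬝ᵥ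
        (L *ᵥ ((1 + δ t • B) *ᵥ f t))) ≤ (1 + c / 2 * δ t) * ((1 - c * δ t) * V t) :=
      mul_le_mul_of_nonneg_left h3 (by positivity)
    have hVt : 0 ≤ V t := dotProduct_self_nonneg_real _
    have hEt : 0 ≤ E t := dotProduct_self_nonneg_real _
    have h6 : (1 + c / 2 * δ t) * ((1 - c * δ t) * V t) ≤ (1 - c / 2 * δ t) * V t := by
      have : 0 ≤ (c * δ t) ^ 2 * V t := by positivity
      nlinarith
    have h7 : (1 + 1 / (c / 2 * δ t)) * (δ t ^ 2 * E t) = (δ t * δ t + δ t * (2 / c)) * E t := by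
      field_simp
    have h8 : (δ t * δ t + δ t * (2 / c)) * E t ≤ δ t * ((ε + 2 / c) * E t) := by
      have : δ t * E t * δ t ≤ δ t * E t * ε := mul_le_mul_of_nonneg_left ht.le (by positivity)
      linarith
    linarith
  have hQ0 : Tendsto (fun t => (1 - P) *ᵥ f t) atTop (𝓝 0) := by
    refine tendsto_zero_of_dotProduct_self (squeeze_zero (fun t => dotProduct_self_nonneg_real _)
      (fun t => (hC _).trans (le_of_eq ?_)) (by simpa using hV0.const_mul C))
    have h1 : P *ᵥ ((1 - P) *ᵥ f t) = 0 := by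
      rw [Matrix.mulVec_mulVec, mul_sub, mul_one, hPP, sub_self, Matrix.zero_mulVec]
    have h2 : L *ᵥ ((1 - P) *ᵥ f t) = L *ᵥ f t := by
      rw [Matrix.mulVec_mulVec, Matrix.mul_sub, Matrix.mul_one, hLP, sub_zero]
    rw [h1, h2, dotProduct_zero, add_zero]
  have hdecomp : ∀ t, ρ t = P *ᵥ (ρ 0 + Minf) + (1 - P) *ᵥ f t - e t := by
    intro t
    have h1 : f t = P *ᵥ f t + (1 - P) *ᵥ f t := by
      rw [← Matrix.add_mulVec, add_sub_cancel, Matrix.one_mulVec]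
    have h2 : P *ᵥ f t = P *ᵥ (ρ 0 + Minf) := by
      simp only [hf]
      rw [Matrix.mulVec_add, hP, ← Matrix.mulVec_add]
      congr 1
      abel
    rw [← h2, ← h1]
    simp [hf, he]
  have hlim := (hQ0.const_add (P *ᵥ (ρ 0 + Minf))).sub he0
  rw [add_zero, sub_zero] at hlim
  exact hlim.congr fun t => (hdecomp t).symm

/-! ### Convergence of square-integrable martingales -/

theorem eLpNorm_two_eq_sqrt {Ω : Type*} [MeasurableSpace Ω] {μ : Measure Ω} {f : Ω → ℝ}
    (hf : MemLp f 2 μ) : eLpNorm f 2 μ = ENNReal.ofReal (Real.sqrt (∫ ω, f ω ^ 2 ∂μ)) := by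
  rw [hf.eLpNorm_eq_integral_rpow_norm (by norm_num) (by norm_num), Real.sqrt_eq_rpow]
  simp

/-- An adapted process with orthogonal increments of summable variances converges almost surely and
in mean square. -/
theorem exists_limit_of_orthogonal_increments {Ω : Type*} {m : MeasurableSpace Ω} {μ : Measure Ω}
    [IsProbabilityMeasure μ] (ℱ : Filtration ℕ m) {f : ℕ → Ω → ℝ}
    (hadp : ∀ t, Measurable[ℱ t] (f t)) (hL2 : ∀ t, MemLp (f t) 2 μ)
    (horth : ∀ t (h : Ω → ℝ), Measurable[ℱ t] h → MemLp h 2 μ →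
      ∫ ω, h ω * (f (t + 1) ω - f t ω) ∂μ = 0)
    {a : ℕ → ℝ} (ha : Summable a) (hinc : ∀ t, ∫ ω, (f (t + 1) ω - f t ω) ^ 2 ∂μ ≤ a t) :
    ∃ g : Ω → ℝ, Measurable g ∧ MemLp g 2 μ ∧
      (∀ᵐ ω ∂μ, Tendsto (fun t => f t ω) atTop (𝓝 (g ω))) ∧
      Tendsto (fun t => ∫ ω, (f t ω - g ω) ^ 2 ∂μ) atTop (𝓝 0) ∧ ∫ ω, g ω ∂μ = ∫ ω, f 0 ω ∂μ := by
  have ha0 : ∀ t, 0 ≤ a t := fun t => (integral_nonneg fun ω => sq_nonneg _).trans (hinc t)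
  have hint : ∀ t, Integrable (f t) μ := fun t => (hL2 t).integrable (by norm_num)
  have hmart : Martingale f ℱ μ := by
    refine martingale_of_setIntegral_eq_succ (fun t => (hadp t).stronglyMeasurable) hint
      fun t s hs => ?_
    -- Orthogonality tested on indicators of past events is the martingale property.
    have h1 := horth t (s.indicator 1) (Measurable.indicator (@measurable_const ℝ Ω _ (ℱ t) 1) hs)
      (memLp_indicator_const 2 (ℱ.le t s hs) (1 : ℝ) (Or.inr (measure_ne_top μ s)))
    have h2 : (fun ω => s.indicator (1 : Ω → ℝ) ω * (f (t + 1) ω - f t ω)) =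
        s.indicator (fun ω => f (t + 1) ω - f t ω) := by
      ext ω
      by_cases h : ω ∈ s <;> simp [h]
    rw [h2, integral_indicator (ℱ.le t s hs), integral_sub (hint _).integrableOn
      (hint _).integrableOn] at h1
    linarith
  have hsq : ∀ t k, ∫ ω, (f (t + k) ω - f t ω) ^ 2 ∂μ ≤ ∑ i ∈ Finset.range k, a (t + i) := by
    intro t k
    induction k with
    | zero => simp
    | succ k ih =>
      have hd1 : MemLp (fun ω => f (t + k) ω - f t ω) 2 μ := (hL2 _).sub (hL2 _)
      have hd2 : MemLp (fun ω => f (t + k + 1) ω - f (t + k) ω) 2 μ := (hL2 _).sub (hL2 _)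
      have h1 := horth (t + k) (fun ω => f (t + k) ω - f t ω)
        ((hadp _).sub ((hadp t).mono (ℱ.mono (by omega)) le_rfl)) hd1
      have h2 : ∀ ω, (f (t + (k + 1)) ω - f t ω) ^ 2 = (f (t + k) ω - f t ω) ^ 2 +
          2 * ((f (t + k) ω - f t ω) * (f (t + k + 1) ω - f (t + k) ω)) +
          (f (t + k + 1) ω - f (t + k) ω) ^ 2 := fun ω => by rw [← add_assoc]; ring
      have i12 : Integrable (fun ω => 2 * ((f (t + k) ω - f t ω) *
          (f (t + k + 1) ω - f (t + k) ω))) μ := (hd1.integrable_mul hd2).const_mul 2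
      have isum : Integrable (fun ω => (f (t + k) ω - f t ω) ^ 2 + 2 * ((f (t + k) ω - f t ω) *
          (f (t + k + 1) ω - f (t + k) ω))) μ := hd1.integrable_sq.add i12
      simp only [h2]
      rw [integral_add isum hd2.integrable_sq,
        integral_add hd1.integrable_sq i12, integral_const_mul, h1, Finset.sum_range_succ]
      have := hinc (t + k)
      linarith
  set tail : ℕ → ℝ := fun t => ∑' i, a i - ∑ i ∈ Finset.range t, a i with htail
  have htail0 : Tendsto tail atTop (𝓝 0) := by
    have := tendsto_const_nhds (x := ∑' i, a i) |>.sub ha.hasSum.tendsto_sum_nat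
    rwa [sub_self] at this
  have hsq' : ∀ t k, ∫ ω, (f (t + k) ω - f t ω) ^ 2 ∂μ ≤ tail t := by
    intro t k
    refine (hsq t k).trans ?_
    have h1 := Finset.sum_range_add a t k
    have h2 := ha.sum_le_tsum (Finset.range (t + k)) fun i _ => ha0 i
    simp only [htail]
    linarith
  have hLp : ∀ t k, eLpNorm (fun ω => f (t + k) ω - f t ω) 2 μ ≤
      ENNReal.ofReal (Real.sqrt (tail t)) := fun t k => by
    have h1 : MemLp (fun ω => f (t + k) ω - f t ω) 2 μ := (hL2 _).sub (hL2 _)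
    rw [eLpNorm_two_eq_sqrt h1]
    exact ENNReal.ofReal_le_ofReal (Real.sqrt_le_sqrt (hsq' t k))
  obtain ⟨R, hR⟩ : ∃ R : NNReal, ∀ t, eLpNorm (f t) 2 μ ≤ R := by
    refine ⟨(ENNReal.ofReal (Real.sqrt (tail 0)) + eLpNorm (f 0) 2 μ).toNNReal, fun t => ?_⟩
    rw [ENNReal.coe_toNNReal (ENNReal.add_ne_top.2 ⟨ENNReal.ofReal_ne_top, (hL2 0).2.ne⟩)]
    have h1 := eLpNorm_add_le (p := 2) ((hL2 t).sub (hL2 0)).1 (hL2 0).1 (by norm_num)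
    rw [sub_add_cancel] at h1
    refine h1.trans (add_le_add_left ?_ _)
    have := hLp 0 t
    rw [zero_add] at this
    exact this
  have hae := hmart.submartingale.ae_tendsto_limitProcess (R := R) fun t =>
    (eLpNorm_le_eLpNorm_of_exponent_le (by norm_num) (hL2 t).1).trans (hR t)
  have hgL := hmart.submartingale.memLp_limitProcess hR
  set g := Filtration.limitProcess f ℱ μ
  -- Fatou's lemma passes the L² bound on `f (t + k) - f t`, uniform in `k`, to the almost sure
  -- limit.
  have hfg : ∀ t, eLpNorm (fun ω => g ω - f t ω) 2 μ ≤ ENNReal.ofReal (Real.sqrt (tail t)) := by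
    intro t
    refine (Lp.eLpNorm_lim_le_liminf_eLpNorm (f := fun k ω => f (t + k) ω - f t ω)
      (fun k => ((hL2 _).sub (hL2 _)).1) _ ?_).trans ?_
    · filter_upwards [hae] with ω hω
      exact ((tendsto_add_atTop_iff_nat t).2 hω |>.congr fun k => by rw [add_comm]).sub_const _
    · refine (liminf_le_liminf (Eventually.of_forall (hLp t))).trans ?_
      simp
  have hlim : Tendsto (fun t => ENNReal.ofReal (Real.sqrt (tail t))) atTop (𝓝 0) := by
    have := ENNReal.tendsto_ofReal ((Real.continuous_sqrt.tendsto 0).comp htail0)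
    simpa using this
  refine ⟨g, Filtration.stronglyMeasurable_limit_process'.measurable, hgL, hae, ?_, ?_⟩
  · refine squeeze_zero (fun t => integral_nonneg fun ω => sq_nonneg _) (fun t => ?_) htail0
    have h1 := hfg t
    have htpos : 0 ≤ tail t := (integral_nonneg fun ω => sq_nonneg _).trans (hsq' t 0)
    have h2 : MemLp (fun ω => g ω - f t ω) 2 μ := hgL.sub (hL2 t)
    rw [eLpNorm_two_eq_sqrt h2,
      ENNReal.ofReal_le_ofReal_iff (Real.sqrt_nonneg _), Real.sqrt_le_sqrt_iff htpos] at h1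
    refine le_of_eq_of_le (integral_congr_ae (Eventually.of_forall fun ω => ?_)) h1
    exact sub_sq_comm _ _
  · have hconst : ∀ t, ∫ ω, f t ω ∂μ = ∫ ω, f 0 ω ∂μ := by
      intro t
      induction t with
      | zero => rfl
      | succ t ih =>
        have h1 := horth t (fun _ => 1) measurable_const (memLp_const 1)
        simp only [one_mul] at h1
        rw [integral_sub (hint _) (hint _)] at h1
        linarith
    have h1 : Tendsto (fun t => ∫ ω, f t ω ∂μ) atTop (𝓝 (∫ ω, g ω ∂μ)) := by
      refine tendsto_integral_of_L1' g hgL.1 (Eventually.of_forall hint) ?_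
      refine tendsto_of_tendsto_of_tendsto_of_le_of_le tendsto_const_nhds hlim (fun _ => zero_le)
        fun t => ?_
      refine (eLpNorm_le_eLpNorm_of_exponent_le (q := 2) (by norm_num)
        ((hL2 t).sub hgL).1).trans ?_
      rw [eLpNorm_sub_comm]
      exact hfg t
    simp only [hconst] at h1
    exact tendsto_nhds_unique h1 tendsto_const_nhds

/-! ### Random linear recursions -/

theorem integrable_dotProduct {Ω ι : Type*} [MeasurableSpace Ω] {μ : Measure Ω} [Fintype ι]
    {X Y : Ω → ι → ℝ} (hX : ∀ p, MemLp (fun ω => X ω p) 2 μ) (hY : ∀ p, MemLp (fun ω => Y ω p) 2 μ) :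
    Integrable (fun ω => X ω ⬝ᵥ Y ω) μ :=
  integrable_finsetSum _ fun p _ => (hX p).integrable_mul (hY p)

theorem memLp_mulVec {Ω ι κ : Type*} [MeasurableSpace Ω] {μ : Measure Ω} [Fintype ι]
    (A : Matrix κ ι ℝ) {X : Ω → ι → ℝ} (hX : ∀ p, MemLp (fun ω => X ω p) 2 μ) (k : κ) :
    MemLp (fun ω => (A *ᵥ X ω) k) 2 μ :=
  memLp_finsetSum _ fun p _ => (hX p).const_mul (A k p)

theorem measurable_mulVec {Ω ι κ : Type*} {m : MeasurableSpace Ω} [Fintype ι]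
    (A : Matrix κ ι ℝ) {X : Ω → ι → ℝ} (hX : ∀ p, Measurable (fun ω => X ω p)) (k : κ) :
    Measurable (fun ω => (A *ᵥ X ω) k) :=
  Finset.measurable_fun_sum _ fun p _ => (hX p).const_mul (A k p)

/-- The process `ρ (t+1) = (1 + δ t B t) ρ t` driven by random matrices `B t` with mean `Bbar` and
second moments bounded by `K`, each entry of `B t` being independent of the past `ℱ t`. -/
structure IsRandomLinearRecursion {Ω ι : Type*} [Fintype ι] {m : MeasurableSpace Ω} (μ : Measure Ω)
    (ℱ : Filtration ℕ m) (B : ℕ → Ω → Matrix ι ι ℝ) (Bbar : Matrix ι ι ℝ) (K : ℝ) (δ : ℕ → ℝ)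
    (ρ₀ : ι → ℝ) (ρ : ℕ → Ω → ι → ℝ) : Prop where
  meas : ∀ t p q, Measurable[ℱ (t + 1)] fun ω => B t ω p q
  indep : ∀ t p q, Indep (MeasurableSpace.comap (fun ω => B t ω p q) inferInstance) (ℱ t) μ
  memLp : ∀ t p q, MemLp (fun ω => B t ω p q) 2 μ
  mean : ∀ t p q, ∫ ω, B t ω p q ∂μ = Bbar p q
  bound : ∀ t p q, ∫ ω, B t ω p q ^ 2 ∂μ ≤ K
  init : ∀ ω, ρ 0 ω = ρ₀
  succ : ∀ t ω, ρ (t + 1) ω = ρ t ω + δ t • (B t ω *ᵥ ρ t ω)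

namespace IsRandomLinearRecursion

variable {Ω ι : Type*} [Fintype ι] {m : MeasurableSpace Ω} {μ : Measure Ω}
  {ℱ : Filtration ℕ m} {B : ℕ → Ω → Matrix ι ι ℝ} {Bbar : Matrix ι ι ℝ}
  {K : ℝ} {δ : ℕ → ℝ} {ρ₀ : ι → ℝ} {ρ : ℕ → Ω → ι → ℝ}

/-- The noise `(B t - Bbar) ρ t` that perturbs the mean recursion. -/
def noise (B : ℕ → Ω → Matrix ι ι ℝ) (Bbar : Matrix ι ι ℝ) (ρ : ℕ → Ω → ι → ℝ) (t : ℕ) (ω : Ω) :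
    ι → ℝ :=
  (B t ω - Bbar) *ᵥ ρ t ω

theorem adapted (h : IsRandomLinearRecursion μ ℱ B Bbar K δ ρ₀ ρ) (t : ℕ) (p : ι) :
    Measurable[ℱ t] fun ω => ρ t ω p := by
  induction t generalizing p with
  | zero =>
    simp only [h.init]
    exact measurable_const
  | succ t ih =>
    have hle : ℱ t ≤ ℱ (t + 1) := ℱ.mono (Nat.le_succ t)
    simp only [h.succ, Pi.add_apply, Pi.smul_apply, smul_eq_mul, Matrix.mulVec, dotProduct]
    exact ((ih p).mono hle le_rfl).add ((Finset.measurable_fun_sum _ fun q _ =>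
      (h.meas t p q).mul ((ih q).mono hle le_rfl)).const_mul (δ t))

theorem measurable_noise (h : IsRandomLinearRecursion μ ℱ B Bbar K δ ρ₀ ρ) (t : ℕ) (p : ι) :
    Measurable[ℱ (t + 1)] fun ω => noise B Bbar ρ t ω p :=
  Finset.measurable_fun_sum _ fun q _ => ((h.meas t p q).sub measurable_const).mul
    ((h.adapted t q).mono (ℱ.mono (Nat.le_succ t)) le_rfl)

theorem indepFun (h : IsRandomLinearRecursion μ ℱ B Bbar K δ ρ₀ ρ) (t : ℕ) (p q : ι) {f : Ω → ℝ}
    (hf : Measurable[ℱ t] f) : IndepFun (fun ω => B t ω p q) f μ := by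
  rw [IndepFun_iff_Indep]
  exact indep_of_indep_of_le_right (h.indep t p q) (measurable_iff_comap_le.1 hf)

theorem succ_eq [DecidableEq ι] (h : IsRandomLinearRecursion μ ℱ B Bbar K δ ρ₀ ρ) (t : ℕ) (ω : Ω) :
    ρ (t + 1) ω = (1 + δ t • Bbar) *ᵥ ρ t ω + δ t • noise B Bbar ρ t ω := by
  rw [h.succ, noise, Matrix.sub_mulVec, Matrix.add_mulVec, Matrix.one_mulVec, Matrix.smul_mulVec,
    smul_sub]
  abel

/-- By independence the product of two square-integrable factors is again square integrable, so no
higher moments of `ρ` are needed. The function `φ` allows for both the entry and its centered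
version. -/
theorem memLp_mul (h : IsRandomLinearRecursion μ ℱ B Bbar K δ ρ₀ ρ) (t : ℕ) (p q : ι)
    {f : Ω → ℝ} (hf : Measurable[ℱ t] f) (hf2 : MemLp f 2 μ) {φ : ℝ → ℝ} (hφ : Measurable φ)
    (hφB : MemLp (fun ω => φ (B t ω p q)) 2 μ) :
    MemLp (fun ω => φ (B t ω p q) * f ω) 2 μ := by
  have hm : AEStronglyMeasurable (fun ω => φ (B t ω p q) * f ω) μ := hφB.1.mul hf2.1
  rw [memLp_two_iff_integrable_sq hm]
  have h1 := ((h.indepFun t p q hf).comp (hφ.pow_const 2)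
    (measurable_id.pow_const 2)).integrable_mul hφB.integrable_sq hf2.integrable_sq
  refine h1.congr (Eventually.of_forall fun ω => ?_)
  simp [mul_pow]

variable [IsProbabilityMeasure μ]

theorem memLp_two (h : IsRandomLinearRecursion μ ℱ B Bbar K δ ρ₀ ρ) (t : ℕ) (p : ι) :
    MemLp (fun ω => ρ t ω p) 2 μ := by
  induction t generalizing p with
  | zero =>
    simp only [h.init]
    exact memLp_const _
  | succ t ih =>
    simp only [h.succ, Pi.add_apply, Pi.smul_apply, smul_eq_mul, Matrix.mulVec, dotProduct]
    exact (ih p).add ((memLp_finsetSum _ fun q _ =>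
      h.memLp_mul t p q (h.adapted t q) (ih q) measurable_id (h.memLp t p q)).const_mul (δ t))

theorem memLp_centered (h : IsRandomLinearRecursion μ ℱ B Bbar K δ ρ₀ ρ) (t : ℕ) (p q : ι) :
    MemLp (fun ω => B t ω p q - Bbar p q) 2 μ :=
  (h.memLp t p q).sub (memLp_const _)

theorem memLp_noise (h : IsRandomLinearRecursion μ ℱ B Bbar K δ ρ₀ ρ) (t : ℕ) (p : ι) :
    MemLp (fun ω => noise B Bbar ρ t ω p) 2 μ :=
  memLp_finsetSum _ fun q _ => h.memLp_mul t p q (h.adapted t q) (h.memLp_two t q)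
    (φ := fun x => x - Bbar p q) (measurable_id.sub_const _) (h.memLp_centered t p q)

/-- The martingale difference property. Each summand is a past variable times one centered entry of
`B t`, so entrywise independence of the past suffices. -/
theorem integral_mul_noise (h : IsRandomLinearRecursion μ ℱ B Bbar K δ ρ₀ ρ) (t : ℕ) (p : ι)
    {f : Ω → ℝ} (hf : Measurable[ℱ t] f) (hf2 : MemLp f 2 μ) :
    ∫ ω, f ω * noise B Bbar ρ t ω p ∂μ = 0 := by
  simp only [noise, Matrix.mulVec, dotProduct, Finset.mul_sum, Matrix.sub_apply]
  rw [integral_finsetSum _ fun q _ => ?_]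
  · refine Finset.sum_eq_zero fun q _ => ?_
    have hfρ : Measurable[ℱ t] fun ω => f ω * ρ t ω q := hf.mul (h.adapted t q)
    have h1 := ((h.indepFun t p q hfρ).comp (φ := fun x => x - Bbar p q) (ψ := id)
      (measurable_id.sub_const _) measurable_id).integral_fun_mul_eq_mul_integral
      (h.memLp_centered t p q).1 (hfρ.mono (ℱ.le t) le_rfl).aestronglyMeasurable
    have h2 : ∫ ω, (B t ω p q - Bbar p q) ∂μ = 0 := by
      rw [integral_sub ((h.memLp t p q).integrable (by norm_num)) (integrable_const _), h.mean]
      simp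
    simp only [Function.comp_apply, id_eq] at h1
    rw [h2, zero_mul] at h1
    rw [← h1]
    exact integral_congr_ae (Eventually.of_forall fun ω => by ring)
  · exact hf2.integrable_mul (h.memLp_mul t p q (h.adapted t q) (h.memLp_two t q)
      (φ := fun x => x - Bbar p q) (measurable_id.sub_const _) (h.memLp_centered t p q))

/-- Cauchy–Schwarz along row `p` separates the squared entries from |ρ|², of which they are
independent; no joint moments of different entries occur. -/
theorem integral_noise_sq_le (h : IsRandomLinearRecursion μ ℱ B Bbar K δ ρ₀ ρ) (t : ℕ) (p : ι) :
    ∫ ω, noise B Bbar ρ t ω p ^ 2 ∂μ ≤ Fintype.card ι * K * ∫ ω, ρ t ω ⬝ᵥ ρ t ω ∂μ := by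
  have hρ : Integrable (fun ω => ρ t ω ⬝ᵥ ρ t ω) μ :=
    integrable_dotProduct (h.memLp_two t) (h.memLp_two t)
  have hρm : Measurable[ℱ t] fun ω => ρ t ω ⬝ᵥ ρ t ω :=
    Finset.measurable_fun_sum _ fun q _ => (h.adapted t q).mul (h.adapted t q)
  have hind : ∀ q, IndepFun (fun ω => (B t ω p q - Bbar p q) ^ 2) (fun ω => ρ t ω ⬝ᵥ ρ t ω) μ :=
    fun q => (h.indepFun t p q hρm).comp (φ := fun x => (x - Bbar p q) ^ 2) (ψ := id)
      ((measurable_id.sub_const _).pow_const 2) measurable_id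
  have hint : ∀ q, Integrable
      (fun ω => (B t ω p q - Bbar p q) ^ 2 * (ρ t ω ⬝ᵥ ρ t ω)) μ := fun q =>
    (hind q).integrable_mul (h.memLp_centered t p q).integrable_sq hρ
  have hvar : ∀ q, ∫ ω, (B t ω p q - Bbar p q) ^ 2 ∂μ ≤ K := fun q => by
    have h1 := variance_le_expectation_sq (μ := μ) (h.memLp t p q).1
    rw [variance_eq_integral (h.memLp t p q).1.aemeasurable, h.mean] at h1
    exact h1.trans (h.bound t p q)
  calc ∫ ω, noise B Bbar ρ t ω p ^ 2 ∂μ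
      ≤ ∫ ω, ∑ q, (B t ω p q - Bbar p q) ^ 2 * (ρ t ω ⬝ᵥ ρ t ω) ∂μ := by
        refine integral_mono (h.memLp_noise t p).integrable_sq
          (integrable_finsetSum _ fun q _ => hint q) fun ω => ?_
        have := sq_dotProduct_le ((B t ω - Bbar) p) (ρ t ω)
        rw [← Finset.sum_mul]
        simpa [noise, Matrix.mulVec, dotProduct, sq] using this
    _ = ∑ q, (∫ ω, (B t ω p q - Bbar p q) ^ 2 ∂μ) * ∫ ω, ρ t ω ⬝ᵥ ρ t ω ∂μ := by
        rw [integral_finsetSum _ fun q _ => hint q]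
        exact Finset.sum_congr rfl fun q _ => (hind q).integral_fun_mul_eq_mul_integral
          (h.memLp_centered t p q).integrable_sq.1 hρ.1
    _ ≤ ∑ _q : ι, K * ∫ ω, ρ t ω ⬝ᵥ ρ t ω ∂μ :=
        Finset.sum_le_sum fun q _ => mul_le_mul_of_nonneg_right (hvar q)
          (integral_nonneg fun ω => dotProduct_self_nonneg_real _)
    _ = Fintype.card ι * K * ∫ ω, ρ t ω ⬝ᵥ ρ t ω ∂μ := by
        rw [Finset.sum_const, Finset.card_univ, nsmul_eq_mul, mul_assoc]

/-- One step of the recursion of second moments. -/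
theorem integral_mulVec_succ_le [DecidableEq ι] {κ : Type*} [Fintype κ]
    (h : IsRandomLinearRecursion μ ℱ B Bbar K δ ρ₀ ρ) (L : Matrix κ ι ℝ) (t : ℕ) :
    ∫ ω, (L *ᵥ ρ (t + 1) ω) ⬝ᵥ (L *ᵥ ρ (t + 1) ω) ∂μ ≤
      ∫ ω, (L *ᵥ ((1 + δ t • Bbar) *ᵥ ρ t ω)) ⬝ᵥ (L *ᵥ ((1 + δ t • Bbar) *ᵥ ρ t ω)) ∂μ +
      δ t ^ 2 * (entrySq L * (Fintype.card ι * (Fintype.card ι * K)) *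
        ∫ ω, ρ t ω ⬝ᵥ ρ t ω ∂μ) := by
  set A : Matrix ι ι ℝ := 1 + δ t • Bbar with hA
  set N : Ω → ι → ℝ := noise B Bbar ρ t with hN
  have hN2 := h.memLp_noise t
  have hA2 : ∀ p, MemLp (fun ω => (A *ᵥ ρ t ω) p) 2 μ := memLp_mulVec A (h.memLp_two t)
  have hLA2 : ∀ k, MemLp (fun ω => (L *ᵥ (A *ᵥ ρ t ω)) k) 2 μ := memLp_mulVec L hA2
  have hLN2 : ∀ k, MemLp (fun ω => (L *ᵥ N ω) k) 2 μ := memLp_mulVec L hN2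
  have hLAm : ∀ k, Measurable[ℱ t] (fun ω => (L *ᵥ (A *ᵥ ρ t ω)) k) :=
    measurable_mulVec L (measurable_mulVec A (h.adapted t))
  have hexp : ∀ ω, (L *ᵥ ρ (t + 1) ω) ⬝ᵥ (L *ᵥ ρ (t + 1) ω) =
      (L *ᵥ (A *ᵥ ρ t ω)) ⬝ᵥ (L *ᵥ (A *ᵥ ρ t ω)) +
      2 * δ t * ((L *ᵥ (A *ᵥ ρ t ω)) ⬝ᵥ (L *ᵥ N ω)) +
      δ t ^ 2 * ((L *ᵥ N ω) ⬝ᵥ (L *ᵥ N ω)) := by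
    intro ω
    rw [h.succ_eq, Matrix.mulVec_add, Matrix.mulVec_smul]
    simp only [add_dotProduct, dotProduct_add, smul_dotProduct, dotProduct_smul, smul_eq_mul]
    rw [dotProduct_comm (L *ᵥ noise B Bbar ρ t ω)]
    ring
  -- The mean step is known at time `t`, hence orthogonal to the noise.
  have hcross : ∫ ω, (L *ᵥ (A *ᵥ ρ t ω)) ⬝ᵥ (L *ᵥ N ω) ∂μ = 0 := by
    have hint : ∀ k, Integrable (fun ω => (L *ᵥ (A *ᵥ ρ t ω)) k * (L *ᵥ N ω) k) μ :=
      fun k => (hLA2 k).integrable_mul (hLN2 k)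
    simp only [dotProduct]
    rw [integral_finsetSum _ fun k _ => hint k]
    refine Finset.sum_eq_zero fun k _ => ?_
    have h1 : ∀ ω, (L *ᵥ (A *ᵥ ρ t ω)) k * (L *ᵥ N ω) k =
        ∑ q, L k q * ((L *ᵥ (A *ᵥ ρ t ω)) k * N ω q) := fun ω => by
      rw [Matrix.mulVec, Matrix.mulVec, dotProduct, dotProduct, Finset.mul_sum]
      exact Finset.sum_congr rfl fun q _ => by ring
    simp only [h1]
    have hint' : ∀ q, Integrable (fun ω => L k q * ((L *ᵥ (A *ᵥ ρ t ω)) k * N ω q)) μ :=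
      fun q => ((hLA2 k).integrable_mul (hN2 q)).const_mul (L k q)
    rw [integral_finsetSum _ fun q _ => hint' q]
    refine Finset.sum_eq_zero fun q _ => ?_
    rw [integral_const_mul, h.integral_mul_noise t q (hLAm k) (hLA2 k), mul_zero]
  have i1 : Integrable (fun ω => (L *ᵥ (A *ᵥ ρ t ω)) ⬝ᵥ (L *ᵥ (A *ᵥ ρ t ω))) μ :=
    integrable_dotProduct hLA2 hLA2
  have i2 : Integrable (fun ω => 2 * δ t * ((L *ᵥ (A *ᵥ ρ t ω)) ⬝ᵥ (L *ᵥ N ω))) μ :=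
    (integrable_dotProduct hLA2 hLN2).const_mul _
  have i12 : Integrable (fun ω => (L *ᵥ (A *ᵥ ρ t ω)) ⬝ᵥ (L *ᵥ (A *ᵥ ρ t ω)) +
    2 * δ t * ((L *ᵥ (A *ᵥ ρ t ω)) ⬝ᵥ (L *ᵥ N ω))) μ := i1.add i2
  have i3 : Integrable (fun ω => (L *ᵥ N ω) ⬝ᵥ (L *ᵥ N ω)) μ := integrable_dotProduct hLN2 hLN2
  have hNN : ∫ ω, N ω ⬝ᵥ N ω ∂μ ≤
      Fintype.card ι * (Fintype.card ι * K) * ∫ ω, ρ t ω ⬝ᵥ ρ t ω ∂μ := by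
    simp only [dotProduct, ← pow_two]
    rw [integral_finsetSum _ fun p _ => (hN2 p).integrable_sq]
    refine (Finset.sum_le_sum fun p _ => h.integral_noise_sq_le t p).trans (le_of_eq ?_)
    rw [Finset.sum_const, Finset.card_univ, nsmul_eq_mul]
    simp only [dotProduct, ← pow_two]
    ring
  have hLNN : ∫ ω, (L *ᵥ N ω) ⬝ᵥ (L *ᵥ N ω) ∂μ ≤ entrySq L *
      (Fintype.card ι * (Fintype.card ι * K)) * ∫ ω, ρ t ω ⬝ᵥ ρ t ω ∂μ := by
    refine (integral_mono i3 ((integrable_dotProduct hN2 hN2).const_mul (entrySq L))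
      fun ω => mulVec_dotProduct_self_le L (N ω)).trans ?_
    rw [integral_const_mul, mul_assoc]
    exact mul_le_mul_of_nonneg_left hNN (entrySq_nonneg L)
  simp only [hexp]
  rw [integral_add i12 (i3.const_mul _), integral_add i1 i2, integral_const_mul,
    integral_const_mul, hcross, mul_zero, add_zero]
  exact add_le_add_right (mul_le_mul_of_nonneg_left hLNN (sq_nonneg _)) _

/-- Mean square and almost sure convergence of the recursion to `P (ρ₀ + M)`, where `P` is the
projection onto the kernel of `Bbar` and `M` is centered. -/
theorem exists_limit [DecidableEq ι] (h : IsRandomLinearRecursion μ ℱ B Bbar K δ ρ₀ ρ)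
    (hδ : ∀ t, 0 < δ t) (hsum : Tendsto (fun N => ∑ t ∈ Finset.range N, δ t) atTop atTop)
    (hδsq : Summable fun t => δ t ^ 2) {P : Matrix ι ι ℝ} {ε : ℝ} (hε : 0 < ε)
    (hPB : P * Bbar = 0) (hBP : Bbar * P = 0) (hPP : P * P = P)
    (hT : ∀ p q, Tendsto (fun k => ((1 + ε • Bbar - P : Matrix ι ι ℝ) ^ k) p q) atTop (𝓝 0)) :
    ∃ M : Ω → ι → ℝ, (∀ p, Measurable fun ω => M ω p) ∧ (∀ p, MemLp (fun ω => M ω p) 2 μ) ∧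
      (∀ p, ∫ ω, M ω p ∂μ = 0) ∧
      TendstoMeanSquare μ ρ (fun ω => P *ᵥ (ρ₀ + M ω)) ∧
      TendstoAlmostSurely μ ρ (fun ω => P *ᵥ (ρ₀ + M ω)) := by
  obtain ⟨k, L, c, C, hc, hC0, hLP, hL, hC⟩ := exists_lyapunov Bbar P hε hPB hBP hPP hT
  have hδ0 : Tendsto δ atTop (𝓝 0) := by
    have h1 := (Real.continuous_sqrt.tendsto 0).comp hδsq.tendsto_atTop_zero
    rw [Real.sqrt_zero] at h1
    exact h1.congr fun t => by simp [Real.sqrt_sq (hδ t).le]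
  have hK : 0 ≤ (Fintype.card ι : ℝ) * (Fintype.card ι * K) := by
    rcases isEmpty_or_nonempty ι with hι | ⟨⟨p⟩⟩
    · simp
    · have : 0 ≤ K := (integral_nonneg fun ω => sq_nonneg _).trans (h.bound 0 p p)
      positivity
  set D : ℝ := (Fintype.card ι : ℝ) * (Fintype.card ι * K) with hD
  set s : ℕ → ℝ := fun t => ∫ ω, ρ t ω ⬝ᵥ ρ t ω ∂μ with hs
  set v : ℕ → ℝ := fun t => ∫ ω, (L *ᵥ ρ t ω) ⬝ᵥ (L *ᵥ ρ t ω) ∂μ with hv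
  set u : ℕ → ℝ := fun t => ∫ ω, (P *ᵥ ρ t ω) ⬝ᵥ (P *ᵥ ρ t ω) ∂μ with hu
  have hL2 : ∀ t p, MemLp (fun ω => (L *ᵥ ρ t ω) p) 2 μ := fun t => memLp_mulVec L (h.memLp_two t)
  have hP2 : ∀ t p, MemLp (fun ω => (P *ᵥ ρ t ω) p) 2 μ := fun t => memLp_mulVec P (h.memLp_two t)
  have hv0 : ∀ t, 0 ≤ v t := fun t => integral_nonneg fun ω => dotProduct_self_nonneg_real _
  have hu0 : ∀ t, 0 ≤ u t := fun t => integral_nonneg fun ω => dotProduct_self_nonneg_real _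
  have hsle : ∀ t, s t ≤ C * (v t + u t) := by
    intro t
    have i1 := integrable_dotProduct (hL2 t) (hL2 t)
    have i2 := integrable_dotProduct (hP2 t) (hP2 t)
    simp only [hs, hv, hu]
    rw [← integral_add i1 i2, ← integral_const_mul]
    exact integral_mono (integrable_dotProduct (h.memLp_two t) (h.memLp_two t))
      ((i1.add i2).const_mul C) fun ω => hC (ρ t ω)
  have hvrec : ∀ t, δ t ≤ ε → v (t + 1) ≤ (1 - c * δ t) * v t + δ t ^ 2 * (entrySq L * D * s t) := by
    intro t ht
    refine (h.integral_mulVec_succ_le L t).trans (add_le_add_left ?_ _)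
    simp only [hv]
    rw [← integral_const_mul]
    have i1 : ∀ p, MemLp (fun ω => (L *ᵥ ((1 + δ t • Bbar) *ᵥ ρ t ω)) p) 2 μ :=
      memLp_mulVec L (memLp_mulVec _ (h.memLp_two t))
    exact integral_mono (integrable_dotProduct i1 i1)
      ((integrable_dotProduct (hL2 t) (hL2 t)).const_mul _) fun ω => hL _ (hδ t).le ht _
  have hurec : ∀ t, u (t + 1) ≤ u t + δ t ^ 2 * (entrySq P * D * s t) := by
    intro t
    refine (h.integral_mulVec_succ_le P t).trans (add_le_add_left (le_of_eq ?_) _)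
    simp only [hu, Matrix.mulVec_mulVec, mul_add, mul_one, Matrix.mul_smul, hPB, smul_zero,
      add_zero]
  set E : ℝ := (entrySq L + entrySq P) * D * C with hE
  have hE0 : 0 ≤ E := mul_nonneg (mul_nonneg (add_nonneg (entrySq_nonneg L) (entrySq_nonneg P)) hK)
    hC0.le
  -- The two moments are bounded together, since the noise feeding each of them is controlled only
  -- through s ≤ C (v + u). The contraction of v is not needed here: growth factors 1 + δ²E with ∑δ²
  -- < ∞ suffice.
  obtain ⟨K₁, hK₁⟩ : ∃ K₁, ∀ t, v t + u t ≤ K₁ := by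
    refine bounded_of_recursive_le (a := fun t => δ t ^ 2 * E) (fun t => add_nonneg (hv0 t) (hu0 t))
      (fun t => mul_nonneg (sq_nonneg _) hE0) (hδsq.mul_right E) ?_
    filter_upwards [hδ0.eventually_lt_const hε] with t ht
    have h1 := hvrec t ht.le
    have h2 := hurec t
    have h3 : δ t ^ 2 * ((entrySq L + entrySq P) * D * s t) ≤
        δ t ^ 2 * ((entrySq L + entrySq P) * D * (C * (v t + u t))) :=
      mul_le_mul_of_nonneg_left (mul_le_mul_of_nonneg_left (hsle t)
        (mul_nonneg (add_nonneg (entrySq_nonneg L) (entrySq_nonneg P)) hK)) (sq_nonneg _)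
    have h4 : 0 ≤ c * δ t * v t := mul_nonneg (mul_nonneg hc.le (hδ t).le) (hv0 t)
    rw [hE]
    linarith
  have hsK : ∀ t, s t ≤ C * K₁ := fun t =>
    (hsle t).trans (mul_le_mul_of_nonneg_left (hK₁ t) hC0.le)
  set S : ℕ → Ω → ι → ℝ := fun t ω => ∑ i ∈ Finset.range t, δ i • noise B Bbar ρ i ω with hS
  have hSsucc : ∀ t ω, S (t + 1) ω - S t ω = δ t • noise B Bbar ρ t ω := fun t ω => by
    simp only [hS, Finset.sum_range_succ, add_sub_cancel_left]
  have hSapp : ∀ t p, (fun ω => S t ω p) =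
      fun ω => ∑ i ∈ Finset.range t, δ i * noise B Bbar ρ i ω p := fun t p => by
    ext ω
    simp [hS]
  have hlim : ∀ p, ∃ g : Ω → ℝ, Measurable g ∧ MemLp g 2 μ ∧
      (∀ᵐ ω ∂μ, Tendsto (fun t => S t ω p) atTop (𝓝 (g ω))) ∧
      Tendsto (fun t => ∫ ω, (S t ω p - g ω) ^ 2 ∂μ) atTop (𝓝 0) ∧
      ∫ ω, g ω ∂μ = ∫ ω, S 0 ω p ∂μ := by
    intro p
    have hinc : ∀ t ω, S (t + 1) ω p - S t ω p = δ t * noise B Bbar ρ t ω p := fun t ω => by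
      have := congrFun (hSsucc t ω) p
      simpa using this
    refine exists_limit_of_orthogonal_increments ℱ (f := fun t ω => S t ω p) (fun t => ?_)
      (fun t => ?_) (fun t f hf hf2 => ?_)
      (hδsq.mul_right (Fintype.card ι * K * (C * K₁))) (fun t => ?_)
    · rw [hSapp]
      refine Finset.measurable_fun_sum _ fun i hi => ((h.measurable_noise i p).mono
        (ℱ.mono (Finset.mem_range.1 hi)) le_rfl).const_mul (δ i)
    · rw [hSapp]
      exact memLp_finsetSum _ fun i _ => (h.memLp_noise i p).const_mul (δ i)
    · simp only [hinc, mul_left_comm _ (δ t)]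
      rw [integral_const_mul, h.integral_mul_noise t p hf hf2, mul_zero]
    · simp only [hinc, mul_pow]
      rw [integral_const_mul]
      have hK' : 0 ≤ K := (integral_nonneg fun ω => sq_nonneg _).trans (h.bound 0 p p)
      exact mul_le_mul_of_nonneg_left ((h.integral_noise_sq_le t p).trans
        (mul_le_mul_of_nonneg_left (hsK t) (by positivity))) (sq_nonneg _)
  choose g hgm hg2 hgae hgL2 hgmean using hlim
  set M : Ω → ι → ℝ := fun ω p => g p ω with hM
  -- As P annihilates `Bbar`, the consensus component only accumulates noise.
  have hPS : ∀ t ω, P *ᵥ ρ t ω = P *ᵥ (ρ₀ + S t ω) := by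
    intro t ω
    induction t with
    | zero => simp [hS, h.init]
    | succ t ih =>
      rw [h.succ_eq, ← hSsucc, Matrix.mulVec_add, Matrix.mulVec_mulVec, mul_add, mul_one,
        Matrix.mul_smul, hPB, smul_zero, add_zero, ih, ← Matrix.mulVec_add]
      congr 1
      abel
  have hlim2 : ∀ p, MemLp (fun ω => (P *ᵥ (ρ₀ + M ω)) p) 2 μ :=
    memLp_mulVec P fun p => (memLp_const (ρ₀ p)).add (hg2 p)
  refine ⟨M, hgm, hg2, fun p => by rw [hgmean]; simp [hS], ⟨h.memLp_two, hlim2, ?_⟩, ?_⟩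
  · have hv_lim : Tendsto v atTop (𝓝 0) := by
      -- With the second moments bounded, the forcing of v is δ times a null sequence, so the
      -- contraction together with ∑δ = ∞ drives v to zero.
      have h1 : Tendsto (fun t => δ t * (entrySq L * D * (C * K₁))) atTop (𝓝 0) := by
        simpa using hδ0.mul_const (entrySq L * D * (C * K₁))
      refine tendsto_zero_of_recursive_le hc hv0 hδ hδ0 hsum h1 ?_
      filter_upwards [hδ0.eventually_lt_const hε] with t ht
      refine (hvrec t ht.le).trans (add_le_add_right ?_ _)
      rw [pow_two, mul_assoc]
      exact mul_le_mul_of_nonneg_left (mul_le_mul_of_nonneg_left (mul_le_mul_of_nonneg_left (hsK t)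
        (mul_nonneg (entrySq_nonneg L) hK)) (hδ t).le) (hδ t).le
    have hw_lim : Tendsto (fun t => ∑ p, ∫ ω, (S t ω p - M ω p) ^ 2 ∂μ) atTop (𝓝 0) := by
      have := tendsto_finsetSum Finset.univ fun p _ => hgL2 p
      simpa using this
    have hS2 : ∀ t p, MemLp (fun ω => S t ω p) 2 μ := fun t p => by
      rw [hSapp]
      exact memLp_finsetSum _ fun i _ => (h.memLp_noise i p).const_mul (δ i)
    have hd2 : ∀ t p, MemLp (fun ω => (S t ω - M ω) p) 2 μ := fun t p => (hS2 t p).sub (hg2 p)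
    have hbd : ∀ t, ∫ ω, ∑ p, (ρ t ω p - (P *ᵥ (ρ₀ + M ω)) p) ^ 2 ∂μ ≤
        2 * (C * v t) + 2 * (entrySq P * ∑ p, ∫ ω, (S t ω p - M ω p) ^ 2 ∂μ) := by
      intro t
      have i1 := (integrable_dotProduct (hL2 t) (hL2 t)).const_mul C |>.const_mul 2
      have i2 := (integrable_dotProduct (hd2 t) (hd2 t)).const_mul (entrySq P) |>.const_mul 2
      have h1 : ∑ p, ∫ ω, (S t ω p - M ω p) ^ 2 ∂μ = ∫ ω, (S t ω - M ω) ⬝ᵥ (S t ω - M ω) ∂μ := by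
        simp only [dotProduct, ← pow_two, Pi.sub_apply]
        have hint : ∀ p, Integrable (fun ω => (S t ω p - M ω p) ^ 2) μ :=
          fun p => (hd2 t p).integrable_sq
        rw [integral_finsetSum _ fun p _ => hint p]
      rw [h1]
      simp only [hv]
      rw [← integral_const_mul, ← integral_const_mul, ← integral_const_mul, ← integral_const_mul,
        ← integral_add i1 i2]
      refine integral_mono (integrable_finsetSum _ fun p _ =>
        ((h.memLp_two t p).sub (hlim2 p)).integrable_sq) (i1.add i2) fun ω => ?_
      -- The transversal part is controlled by v, the consensus part by the L² convergence of the
      -- martingale.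
      have h2 : ρ t ω - P *ᵥ (ρ₀ + M ω) = (1 - P) *ᵥ ρ t ω + P *ᵥ (S t ω - M ω) := by
        rw [Matrix.sub_mulVec, Matrix.one_mulVec, hPS, Matrix.mulVec_sub, Matrix.mulVec_add,
          Matrix.mulVec_add]
        abel
      have h3 := dotProduct_self_add_le ((1 - P) *ᵥ ρ t ω) (P *ᵥ (S t ω - M ω)) one_pos
      rw [← h2] at h3
      have h4 := hC ((1 - P) *ᵥ ρ t ω)
      have h5 : P *ᵥ ((1 - P) *ᵥ ρ t ω) = 0 := by
        rw [Matrix.mulVec_mulVec, mul_sub, mul_one, hPP, sub_self, Matrix.zero_mulVec]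
      have h6 : L *ᵥ ((1 - P) *ᵥ ρ t ω) = L *ᵥ ρ t ω := by
        rw [Matrix.mulVec_mulVec, Matrix.mul_sub, Matrix.mul_one, hLP, sub_zero]
      rw [h5, h6, dotProduct_zero, add_zero] at h4
      have h7 := mulVec_dotProduct_self_le P (S t ω - M ω)
      have h8 : ∑ p, (ρ t ω p - (P *ᵥ (ρ₀ + M ω)) p) ^ 2 =
          (ρ t ω - P *ᵥ (ρ₀ + M ω)) ⬝ᵥ (ρ t ω - P *ᵥ (ρ₀ + M ω)) := by
        simp only [dotProduct, ← pow_two, Pi.sub_apply]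
      simp only [h8]
      linarith
    refine squeeze_zero (fun t => integral_nonneg fun ω =>
      Finset.sum_nonneg fun p _ => sq_nonneg _) hbd ?_
    have := ((hv_lim.const_mul C).const_mul 2).add ((hw_lim.const_mul (entrySq P)).const_mul 2)
    simpa using this
  · filter_upwards [ae_all_iff.2 hgae] with ω hω
    have := tendsto_of_perturbed_recursion hc hε hPB hPP hLP hL hC hδ hδ0 hsum
      (ρ := fun t => ρ t ω) (M := fun t => S t ω) (Minf := M ω) (by simp [hS])
      (tendsto_pi_nhds.2 hω) (fun t => by rw [hSsucc, h.succ_eq])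
    rwa [h.init] at this

end IsRandomLinearRecursion

/-! ### Independence of past and present, and moment bounds -/

/-- Two independent families of independent random variables form one independent family. -/
theorem iIndepFun_sumElim {Ω ι κ : Type*} [MeasurableSpace Ω] {μ : Measure Ω}
    {x : ι → Ω → ℝ} {y : κ → Ω → ℝ} (hx : iIndepFun x μ) (hy : iIndepFun y μ)
    (hxy : IndepFun (fun ω i => x i ω) (fun ω k => y k ω) μ) : iIndepFun (Sum.elim x y) μ := by
  rw [iIndepFun_iff_measure_inter_preimage_eq_mul]
  intro S A hA
  have h1 : (⋂ i ∈ S, Sum.elim x y i ⁻¹' A i) =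
      (fun ω i => x i ω) ⁻¹' (⋂ i ∈ S.toLeft, (fun v : ι → ℝ => v i) ⁻¹' A (Sum.inl i)) ∩
      (fun ω k => y k ω) ⁻¹' (⋂ k ∈ S.toRight, (fun v : κ → ℝ => v k) ⁻¹' A (Sum.inr k)) := by
    ext ω
    simp [Sum.forall]
  have hAl : ∀ i ∈ S.toLeft, MeasurableSet (A (Sum.inl i)) := fun i hi =>
    hA _ (Finset.mem_toLeft.1 hi)
  have hAr : ∀ k ∈ S.toRight, MeasurableSet (A (Sum.inr k)) := fun k hk =>
    hA _ (Finset.mem_toRight.1 hk)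
  have h2 := iIndepFun_iff_measure_inter_preimage_eq_mul.1 hx S.toLeft (sets := fun i =>
    A (Sum.inl i)) hAl
  have h3 := iIndepFun_iff_measure_inter_preimage_eq_mul.1 hy S.toRight (sets := fun k =>
    A (Sum.inr k)) hAr
  rw [h1, hxy.measure_inter_preimage_eq_mul _ _
    (S.toLeft.measurableSet_biInter fun i hi => measurable_pi_apply i (hAl i hi))
    (S.toRight.measurableSet_biInter fun k hk => measurable_pi_apply k (hAr k hk))]
  conv_rhs => rw [← Finset.toLeft_disjSum_toRight (u := S), Finset.prod_disjSum]
  simp only [Sum.elim_inl, Sum.elim_inr]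
  rw [← h2, ← h3]
  simp only [Set.preimage_iInter, ← Set.preimage_comp]
  rfl

/-- The σ-algebra generated by the variables `Z a` with `time a ∈ T`. -/
abbrev observed {Ω A : Type*} (Z : A → Ω → ℝ) (time : A → ℕ) (T : Set ℕ) : MeasurableSpace Ω :=
  ⨆ a ∈ {a | time a ∈ T}, MeasurableSpace.comap (Z a) inferInstance

theorem observed_mono {Ω A : Type*} (Z : A → Ω → ℝ) (time : A → ℕ) {S T : Set ℕ} (h : S ⊆ T) :
    observed Z time S ≤ observed Z time T :=
  biSup_mono fun _ ha => h ha

theorem observed_le {Ω A : Type*} [m : MeasurableSpace Ω] {Z : A → Ω → ℝ} {time : A → ℕ}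
    (hZ : ∀ a, Measurable (Z a)) (T : Set ℕ) : observed Z time T ≤ m :=
  iSup₂_le fun a _ => (hZ a).comap_le

theorem measurable_observed {Ω A : Type*} (Z : A → Ω → ℝ) (time : A → ℕ) {T : Set ℕ} {a : A}
    (ha : time a ∈ T) : Measurable[observed Z time T] (Z a) :=
  measurable_iff_comap_le.2 (le_iSup₂_of_le a ha le_rfl)

theorem indep_observed {Ω A : Type*} [MeasurableSpace Ω] {μ : Measure Ω} {Z : A → Ω → ℝ}
    (hZ : ∀ a, Measurable (Z a)) (hind : iIndepFun Z μ) (time : A → ℕ) {S T : Set ℕ}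
    (hST : Disjoint S T) : Indep (observed Z time S) (observed Z time T) μ :=
  indep_iSup_of_disjoint (fun a => (hZ a).comap_le) hind
    (Set.disjoint_left.2 fun _ ha hb => Set.disjoint_left.1 hST ha hb)

/-- The filtration of the past: `Z a` is known after time `time a`. -/
def pastFiltration {Ω A : Type*} [m : MeasurableSpace Ω] {Z : A → Ω → ℝ}
    (hZ : ∀ a, Measurable (Z a)) (time : A → ℕ) : Filtration ℕ m where
  seq t := observed Z time (Set.Iio t)
  mono' _ _ h := observed_mono Z time (Set.Iio_subset_Iio h)
  le' _ := observed_le hZ _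

/-- `f` is integrable with expectation `c`. -/
def HasMean {Ω : Type*} [MeasurableSpace Ω] (μ : Measure Ω) (f : Ω → ℝ) (c : ℝ) : Prop :=
  Integrable f μ ∧ ∫ ω, f ω ∂μ = c

namespace HasMean

variable {Ω : Type*} [MeasurableSpace Ω] {μ : Measure Ω} {f g : Ω → ℝ} {a b : ℝ}

theorem add (hf : HasMean μ f a) (hg : HasMean μ g b) :
    HasMean μ (fun ω => f ω + g ω) (a + b) :=
  ⟨hf.1.add hg.1, by rw [integral_add hf.1 hg.1, hf.2, hg.2]⟩

theorem const_mul (hf : HasMean μ f a) (c : ℝ) : HasMean μ (fun ω => c * f ω) (c * a) :=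
  ⟨hf.1.const_mul c, by rw [integral_const_mul, hf.2]⟩

theorem const [IsProbabilityMeasure μ] (c : ℝ) : HasMean μ (fun _ => c) c :=
  ⟨integrable_const c, by simp⟩

theorem congr (hf : HasMean μ f a) (h : ∀ ω, g ω = f ω) (hab : b = a) : HasMean μ g b := by
  rw [show g = f from funext h, hab]
  exact hf

theorem mul_of_indepFun (hf : HasMean μ f a) (hg : HasMean μ g b) (h : IndepFun f g μ) :
    HasMean μ (fun ω => f ω * g ω) (a * b) :=
  ⟨h.integrable_mul hf.1 hg.1, by
    rw [h.integral_fun_mul_eq_mul_integral hf.1.1 hg.1.1, hf.2, hg.2]⟩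

end HasMean

/-- Meant for `f` a sample at time t and `g` the sample at time 0: a value expressed through `g`
does not depend on t. -/
theorem hasMean_pow_four {Ω : Type*} [MeasurableSpace Ω] {μ : Measure Ω} [IsFiniteMeasure μ]
    {f g : Ω → ℝ} (hfg : IdentDistrib f g μ μ) (hf : MemLp f 4 μ) :
    HasMean μ (fun ω => f ω ^ 4) (∫ ω, g ω ^ 4 ∂μ) := by
  refine ⟨?_, (hfg.comp (measurable_id.pow_const 4)).integral_eq⟩
  refine (hf.integrable_norm_pow (p := 4) (by norm_num)).congr (Eventually.of_forall fun ω => ?_)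
  simpa using Even.pow_abs (by decide) (f ω)

/-- Expectation of a product of two affine forms in a signal and two noises. -/
theorem hasMean_affine_mul {Ω : Type*} [MeasurableSpace Ω] {μ : Measure Ω} [IsProbabilityMeasure μ]
    {x e e' : Ω → ℝ} {m₁ m₂ c : ℝ} (hx : HasMean μ x m₁) (hxx : HasMean μ (fun ω => x ω ^ 2) m₂)
    (he : HasMean μ e 0) (he' : HasMean μ e' 0) (hxe : HasMean μ (fun ω => x ω * e ω) 0)
    (hxe' : HasMean μ (fun ω => x ω * e' ω) 0) (hee' : HasMean μ (fun ω => e ω * e' ω) c)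
    (u₀ u₁ u₂ w₀ w₁ w₂ : ℝ) :
    HasMean μ (fun ω => (u₀ + u₁ * x ω + u₂ * e ω) * (w₀ + w₁ * x ω + w₂ * e' ω))
      (u₀ * w₀ + (u₀ * w₁ + u₁ * w₀) * m₁ + u₁ * w₁ * m₂ + u₂ * w₂ * c) := by
  refine ((((((((HasMean.const (u₀ * w₀)).add (hx.const_mul (u₀ * w₁ + u₁ * w₀))).add
    (hxx.const_mul (u₁ * w₁))).add (hee'.const_mul (u₂ * w₂))).add (he.const_mul (u₂ * w₀))).add
    (he'.const_mul (u₀ * w₂))).add (hxe.const_mul (u₂ * w₁))).add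
    (hxe'.const_mul (u₁ * w₂))).congr (fun ω => by ring) (by ring)

theorem add_add_pow_four_le (a b c : ℝ) : (a + b + c) ^ 4 ≤ 27 * (a ^ 4 + b ^ 4 + c ^ 4) := by
  have h1 : (a + b + c) ^ 2 ≤ 3 * (a ^ 2 + b ^ 2 + c ^ 2) := by
    nlinarith [sq_nonneg (a - b), sq_nonneg (b - c), sq_nonneg (a - c)]
  have h2 : (a ^ 2 + b ^ 2 + c ^ 2) ^ 2 ≤ 3 * (a ^ 4 + b ^ 4 + c ^ 4) := by
    nlinarith [sq_nonneg (a ^ 2 - b ^ 2), sq_nonneg (b ^ 2 - c ^ 2), sq_nonneg (a ^ 2 - c ^ 2)]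
  have h3 : ((a + b + c) ^ 2) ^ 2 ≤ (3 * (a ^ 2 + b ^ 2 + c ^ 2)) ^ 2 :=
    pow_le_pow_left₀ (sq_nonneg _) h1 2
  nlinarith

/-- Square integrability, with an explicit bound, of a product of two affine forms. -/
theorem memLp_affine_mul {Ω : Type*} [MeasurableSpace Ω] {μ : Measure Ω} [IsProbabilityMeasure μ]
    {x e e' : Ω → ℝ} (hxm : Measurable x) (hem : Measurable e) (hem' : Measurable e')
    {m₁ m₂ m₃ : ℝ} (hx : HasMean μ (fun ω => x ω ^ 4) m₁) (he : HasMean μ (fun ω => e ω ^ 4) m₂)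
    (he' : HasMean μ (fun ω => e' ω ^ 4) m₃) (u₀ u₁ u₂ w₀ w₁ w₂ r k : ℝ) :
    MemLp (fun ω => (u₀ + u₁ * x ω + u₂ * e ω) * r * (w₀ + w₁ * x ω + w₂ * e' ω) + k) 2 μ ∧
    ∫ ω, ((u₀ + u₁ * x ω + u₂ * e ω) * r * (w₀ + w₁ * x ω + w₂ * e' ω) + k) ^ 2 ∂μ ≤
      r ^ 2 * 27 * (u₀ ^ 4 + w₀ ^ 4 + (u₁ ^ 4 + w₁ ^ 4) * m₁ + u₂ ^ 4 * m₂ + w₂ ^ 4 * m₃) +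
        2 * k ^ 2 := by
  have hdom := (((((HasMean.const (μ := μ) (u₀ ^ 4 + w₀ ^ 4)).add
    (hx.const_mul (u₁ ^ 4 + w₁ ^ 4))).add (he.const_mul (u₂ ^ 4))).add
    (he'.const_mul (w₂ ^ 4))).const_mul (r ^ 2 * 27)).add (HasMean.const (2 * k ^ 2))
  have hle : ∀ ω, ((u₀ + u₁ * x ω + u₂ * e ω) * r * (w₀ + w₁ * x ω + w₂ * e' ω) + k) ^ 2 ≤
      r ^ 2 * 27 * (u₀ ^ 4 + w₀ ^ 4 + (u₁ ^ 4 + w₁ ^ 4) * x ω ^ 4 + u₂ ^ 4 * e ω ^ 4 +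
        w₂ ^ 4 * e' ω ^ 4) + 2 * k ^ 2 := by
    intro ω
    set U := u₀ + u₁ * x ω + u₂ * e ω with hU
    set W := w₀ + w₁ * x ω + w₂ * e' ω with hW
    have h1 : (U * r * W + k) ^ 2 ≤ 2 * (U * r * W) ^ 2 + 2 * k ^ 2 := by
      nlinarith [sq_nonneg (U * r * W - k)]
    -- From 2U²W² ≤ U⁴ + W⁴: this is where fourth moments of signal and noise are needed.
    have h2 : 2 * (U * r * W) ^ 2 ≤ r ^ 2 * (U ^ 4 + W ^ 4) := by
      have : 0 ≤ r ^ 2 * (U ^ 2 - W ^ 2) ^ 2 := by positivity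
      linarith
    have h3 := add_add_pow_four_le u₀ (u₁ * x ω) (u₂ * e ω)
    have h4 := add_add_pow_four_le w₀ (w₁ * x ω) (w₂ * e' ω)
    rw [← hU, mul_pow, mul_pow] at h3
    rw [← hW, mul_pow, mul_pow] at h4
    have h5 := mul_le_mul_of_nonneg_left (add_le_add h3 h4) (sq_nonneg r)
    linarith
  have hmeas : Measurable
      (fun ω => (u₀ + u₁ * x ω + u₂ * e ω) * r * (w₀ + w₁ * x ω + w₂ * e' ω) + k) := by
    fun_prop
  have hint : Integrable (fun ω =>
      ((u₀ + u₁ * x ω + u₂ * e ω) * r * (w₀ + w₁ * x ω + w₂ * e' ω) + k) ^ 2) μ := by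
    refine hdom.1.mono' (hmeas.pow_const 2).aestronglyMeasurable (Eventually.of_forall fun ω => ?_)
    rw [Real.norm_of_nonneg (sq_nonneg _)]
    exact hle ω
  refine ⟨(memLp_two_iff_integrable_sq hmeas.aestronglyMeasurable).2 hint, ?_⟩
  rw [← hdom.2]
  exact integral_mono hint hdom.1 hle

/-! ### The calibration algorithm as a random linear recursion -/

section calibration

variable {n : ℕ}

/-- The gain and offset components of the regressor `(α y, β y + 1)` for `y = α x + β + e`. -/
def regressor (a b x e : ℝ) (c : Fin 2) : ℝ :=
  ![a * b, b ^ 2 + 1] c + ![a ^ 2, a * b] c * x + ![a, b] c * e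

/-- The coefficients of the calibrated output as a linear form in the equivalent parameters. -/
noncomputable def outputCoeff (a x e : ℝ) (c : Fin 2) : ℝ :=
  ![0, 1] c + ![1, 0] c * x + ![a⁻¹, 0] c * e

/-- The deterministic term that compensates the bias due to measurement noise. -/
noncomputable def biasCompensation (γ : Fin n → Fin n → ℝ) (α β σ : Fin n → ℝ)
    (p q : Fin n × Fin 2) : ℝ :=
  if p.1 = q.1 then ![![1, β p.1 / α p.1] p.2 * (σ p.1 ^ 2 * ∑ j, γ p.1 j), 0] q.2 else 0

/-- The random matrix of the recursion for the equivalent gains and offsets, for a signal value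
`x` and noise values `e`. -/
noncomputable def iterationMatrix (γ : Fin n → Fin n → ℝ) (α β σ : Fin n → ℝ) (x : ℝ)
    (e : Fin n → ℝ) : Matrix (Fin n × Fin 2) (Fin n × Fin 2) ℝ :=
  Matrix.of fun p q => regressor (α p.1) (β p.1) x (e p.1) p.2 * weightMatrix γ p.1 q.1 *
    outputCoeff (α q.1) x (e q.1) q.2 + biasCompensation γ α β σ p q

theorem sum_nbrs {G : Digraph (Fin n)} {γ : Fin n → Fin n → ℝ}
    (hγzero : ∀ i j, ¬ G.Adj j i → γ i j = 0) (i : Fin n) (f : Fin n → ℝ) :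
    ∑ j ∈ nbrs G i, γ i j * f j = ∑ j, γ i j * f j := by
  refine Finset.sum_subset (Finset.subset_univ _) fun j _ hj => ?_
  have : ¬ G.Adj j i := by simpa [nbrs] using hj
  rw [hγzero i j this, zero_mul]

/-- In equivalent parameters z_j = g_j (x + e_j/α_j) + f_j is linear, and multiplying the update by
C_i turns (y_i, 1) into the regressor (α_i y_i, β_i y_i + 1). The compensation term involves a_i =
g_i/α_i. -/
theorem rhoOf_step {G : Digraph (Fin n)} {γ : Fin n → Fin n → ℝ}
    (hγzero : ∀ i j, ¬ G.Adj j i → γ i j = 0) {α : Fin n → ℝ} (hα : ∀ i, α i ≠ 0)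
    (β σ : Fin n → ℝ) (d x : ℝ) (e : Fin n → ℝ) (θ : Fin n → Fin 2 → ℝ) :
    rhoOf α β (step G γ σ d (fun i => α i * x + β i + e i) θ) =
      rhoOf α β θ + d • (iterationMatrix γ α β σ x e *ᵥ rhoOf α β θ) := by
  set y : Fin n → ℝ := fun i => α i * x + β i + e i with hy
  have hz : ∀ j, outputCoeff (α j) x (e j) 0 * rhoOf α β θ (j, 0) +
      outputCoeff (α j) x (e j) 1 * rhoOf α β θ (j, 1) = calibrated θ y j := by
    intro j
    have := hα j
    simp [outputCoeff, rhoOf, calibrated, hy, Matrix.mulVec, dotProduct, Fin.sum_univ_two]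
    field_simp
    ring
  have hB : ∀ i c, (iterationMatrix γ α β σ x e *ᵥ rhoOf α β θ) (i, c) =
      regressor (α i) (β i) x (e i) c * ∑ j, γ i j * (calibrated θ y j - calibrated θ y i) +
      ![1, β i / α i] c * (σ i ^ 2 * ∑ j, γ i j) * rhoOf α β θ (i, 0) := by
    intro i c
    have h1 := weightMatrix_sum_smul γ (calibrated θ y) i
    simp only [smul_eq_mul] at h1
    have h2 : ∑ q, biasCompensation γ α β σ (i, c) q * rhoOf α β θ q =
        ![1, β i / α i] c * (σ i ^ 2 * ∑ j, γ i j) * rhoOf α β θ (i, 0) := by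
      rw [Fintype.sum_prod_type, Finset.sum_eq_single i
        (fun j _ hj => by simp [biasCompensation, hj.symm]) (by simp)]
      simp [biasCompensation, Fin.sum_univ_two]
    rw [← h1, ← h2, Finset.mul_sum, Matrix.mulVec, dotProduct]
    simp only [iterationMatrix, Matrix.of_apply, add_mul, Finset.sum_add_distrib]
    congr 1
    rw [Fintype.sum_prod_type]
    refine Finset.sum_congr rfl fun j _ => ?_
    rw [Fin.sum_univ_two, ← hz j]
    ring
  have hd : ∀ i, ∑ j ∈ nbrs G i, γ i j = ∑ j, γ i j := fun i => by
    simpa using sum_nbrs hγzero i fun _ => 1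
  have hstep : ∀ i c, step G γ σ d y θ i c = θ i c +
      d * ((∑ j, γ i j * (calibrated θ y j - calibrated θ y i)) * ![y i, 1] c +
        ![σ i ^ 2 * (∑ j, γ i j) * θ i 0, 0] c) := by
    intro i c
    simp only [step, ← Finset.sum_smul, sum_nbrs hγzero, hd]
    fin_cases c <;> simp [dotProduct, Fin.sum_univ_two]
  ext ⟨i, c⟩
  have := hα i
  rw [Pi.add_apply, Pi.smul_apply, hB]
  have hr : ∀ (θ' : Fin n → Fin 2 → ℝ), rhoOf α β θ' (i, 0) = α i * θ' i 0 ∧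
      rhoOf α β θ' (i, 1) = β i * θ' i 0 + θ' i 1 := fun θ' => by
    simp [rhoOf, Matrix.mulVec, dotProduct, Fin.sum_univ_two]
  fin_cases c
  · simp only [Fin.zero_eta, (hr _).1, hstep]
    simp [regressor, hy]
    ring
  · simp only [Fin.mk_one, (hr _).1, (hr _).2, hstep]
    generalize ∑ j, γ i j * (calibrated θ y j - calibrated θ y i) = D
    simp [regressor, hy]
    field_simp
    ring

/-- The expectation of the iteration matrix is `BBar`. -/
theorem mean_identity {γ : Fin n → Fin n → ℝ} (hγ : ∀ i, γ i i = 0) {α : Fin n → ℝ}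
    (hα : ∀ i, α i ≠ 0) (β σ : Fin n → ℝ) (xbar s : ℝ) (p q : Fin n × Fin 2) :
    weightMatrix γ p.1 q.1 *
      (![α p.1 * β p.1, β p.1 ^ 2 + 1] p.2 * ![0, 1] q.2 +
        (![α p.1 * β p.1, β p.1 ^ 2 + 1] p.2 * ![1, 0] q.2 +
          ![α p.1 ^ 2, α p.1 * β p.1] p.2 * ![0, 1] q.2) * xbar +
        ![α p.1 ^ 2, α p.1 * β p.1] p.2 * ![1, 0] q.2 * s ^ 2 +
        ![α p.1, β p.1] p.2 * ![(α q.1)⁻¹, 0] q.2 * (if p.1 = q.1 then σ p.1 ^ 2 else 0)) +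
      biasCompensation γ α β σ p q = BBar γ α β xbar s p q := by
  obtain ⟨i, c⟩ := p
  obtain ⟨j, c'⟩ := q
  rw [BBar_apply]
  have := hα i
  -- Only in a diagonal block do regressor and output share the same noise; its contribution,
  -- proportional to -σ_i² ∑_k γ_ik, is cancelled by `biasCompensation`.
  by_cases hij : i = j
  · subst hij
    have hw : weightMatrix γ i i = -∑ k, γ i k := by
      rw [weightMatrix, Matrix.of_apply, if_pos rfl, Finset.filter_ne',
        ← Finset.add_sum_erase _ _ (Finset.mem_univ i), hγ, zero_add]
    simp only [hw, biasCompensation, if_true, phiBar]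
    fin_cases c <;> fin_cases c' <;> simp <;> field_simp <;> ring
  · simp only [biasCompensation, if_neg hij, phiBar]
    fin_cases c <;> fin_cases c' <;> simp <;> ring

end calibration

theorem measurable_regressor {Ω : Type*} {m : MeasurableSpace Ω} {x e : Ω → ℝ} (hx : Measurable x)
    (he : Measurable e) (a b : ℝ) (c : Fin 2) :
    Measurable fun ω => regressor a b (x ω) (e ω) c := by
  unfold regressor
  fun_prop

theorem measurable_outputCoeff {Ω : Type*} {m : MeasurableSpace Ω} {x e : Ω → ℝ}
    (hx : Measurable x) (he : Measurable e) (a : ℝ) (c : Fin 2) :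
    Measurable fun ω => outputCoeff a (x ω) (e ω) c := by
  unfold outputCoeff
  fun_prop

/-- The process of equivalent gains and offsets is a random linear recursion with mean matrix
`BBar`. -/
theorem rhoHat_isRandomLinearRecursion {Ω : Type*} [MeasurableSpace Ω] {μ : Measure Ω}
    [IsProbabilityMeasure μ] {n : ℕ} {G : Digraph (Fin n)} (hloop : ∀ i, ¬ G.Adj i i)
    {γ : Fin n → Fin n → ℝ} (hγzero : ∀ i j, ¬ G.Adj j i → γ i j = 0)
    {α : Fin n → ℝ} (β : Fin n → ℝ) (hα : ∀ i, α i ≠ 0)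
    {x : ℕ → Ω → ℝ} {xbar s : ℝ} (hx_meas : ∀ t, Measurable (x t))
    (hx_indep : iIndepFun x μ) (hx_ident : ∀ t, IdentDistrib (x t) (x 0) μ μ)
    (hx_four : ∀ t, MemLp (x t) 4 μ) (hx_mean : ∀ t, ∫ ω, x t ω ∂μ = xbar)
    (hx_sq : ∀ t, ∫ ω, x t ω ^ 2 ∂μ = s ^ 2)
    {η : Fin n → ℕ → Ω → ℝ} {σ : Fin n → ℝ} (hη_meas : ∀ i t, Measurable (η i t))
    (hη_indep : iIndepFun (fun p : Fin n × ℕ => η p.1 p.2) μ)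
    (hη_ident : ∀ i t, IdentDistrib (η i t) (η i 0) μ μ)
    (hη_four : ∀ i t, MemLp (η i t) 4 μ) (hη_mean : ∀ i t, ∫ ω, η i t ω ∂μ = 0)
    (hη_sq : ∀ i t, ∫ ω, η i t ω ^ 2 ∂μ = σ i ^ 2)
    (hxη : IndepFun (fun ω (t : ℕ) => x t ω) (fun ω (p : Fin n × ℕ) => η p.1 p.2 ω) μ)
    (δ : ℕ → ℝ) :
    ∃ (ℱ : Filtration ℕ ‹MeasurableSpace Ω›) (K : ℝ), IsRandomLinearRecursion μ ℱ
      (fun t ω => iterationMatrix γ α β σ (x t ω) fun i => η i t ω) (BBar γ α β xbar s) K δ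
      (rhoOf α β (thetaInit n)) (rhoHat G γ α β σ δ x η) := by
  set Z : ℕ ⊕ Fin n × ℕ → Ω → ℝ := Sum.elim x fun p => η p.1 p.2 with hZdef
  have hZ : ∀ a, Measurable (Z a) := by
    rintro (t | p)
    · exact hx_meas t
    · exact hη_meas p.1 p.2
  have hind : iIndepFun Z μ := iIndepFun_sumElim hx_indep hη_indep hxη
  let time : ℕ ⊕ Fin n × ℕ → ℕ := Sum.elim id Prod.snd
  have hmeas : ∀ t (T : Set ℕ), t ∈ T → ∀ p q, Measurable[observed Z time T]
      fun ω => iterationMatrix γ α β σ (x t ω) (fun i => η i t ω) p q := by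
    intro t T ht p q
    have h1 : Measurable[observed Z time T] (x t) :=
      measurable_observed Z time (a := Sum.inl t) ht
    have h2 : ∀ i, Measurable[observed Z time T] (η i t) := fun i =>
      measurable_observed Z time (a := Sum.inr (i, t)) ht
    exact (((measurable_regressor h1 (h2 p.1) _ _ _).mul measurable_const).mul
      (measurable_outputCoeff h1 (h2 q.1) _ _)).add measurable_const
  have hxm : ∀ t, HasMean μ (x t) xbar := fun t => ⟨(hx_four t).integrable (by norm_num), hx_mean t⟩
  have hηm : ∀ i t, HasMean μ (η i t) 0 := fun i t =>
    ⟨(hη_four i t).integrable (by norm_num), hη_mean i t⟩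
  have hxx : ∀ t, HasMean μ (fun ω => x t ω ^ 2) (s ^ 2) := fun t =>
    ⟨((hx_four t).mono_exponent (by norm_num)).integrable_sq, hx_sq t⟩
  have hxe : ∀ i t, HasMean μ (fun ω => x t ω * η i t ω) 0 := fun i t =>
    ((hxm t).mul_of_indepFun (hηm i t)
      (hxη.comp (measurable_pi_apply t) (measurable_pi_apply (i, t)))).congr (fun _ => rfl) (by simp)
  have hee : ∀ i j t, HasMean μ (fun ω => η i t ω * η j t ω) (if i = j then σ i ^ 2 else 0) := by
    intro i j t
    by_cases hij : i = j
    · subst hij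
      rw [if_pos rfl]
      have h1 : HasMean μ (fun ω => η i t ω ^ 2) (σ i ^ 2) :=
        ⟨((hη_four i t).mono_exponent (by norm_num)).integrable_sq, hη_sq i t⟩
      exact h1.congr (fun ω => (pow_two _).symm) rfl
    · rw [if_neg hij]
      have h1 := hη_indep.indepFun (i := (i, t)) (j := (j, t)) (by simpa using hij)
      exact ((hηm i t).mul_of_indepFun (hηm j t) h1).congr (fun _ => rfl) (by simp)
  have hx4 := fun t => hasMean_pow_four (hx_ident t) (hx_four t)
  have hη4 := fun i t => hasMean_pow_four (hη_ident i t) (hη_four i t)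
  -- The bound left open below is filled in by `memLp_affine_mul`; it involves only the fourth
  -- moments at time 0, hence is uniform in `t`.
  obtain ⟨Kb, hKb⟩ : ∃ Kb : Fin n × Fin 2 → Fin n × Fin 2 → ℝ, ∀ t p q,
      MemLp (fun ω => iterationMatrix γ α β σ (x t ω) (fun i => η i t ω) p q) 2 μ ∧
      ∫ ω, iterationMatrix γ α β σ (x t ω) (fun i => η i t ω) p q ^ 2 ∂μ ≤ Kb p q :=
    ⟨fun p q => _, fun t p q => memLp_affine_mul (hx_meas t) (hη_meas p.1 t)
      (hη_meas q.1 t) (hx4 t) (hη4 p.1 t) (hη4 q.1 t)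
      (![α p.1 * β p.1, β p.1 ^ 2 + 1] p.2) (![α p.1 ^ 2, α p.1 * β p.1] p.2)
      (![α p.1, β p.1] p.2) (![0, 1] q.2) (![1, 0] q.2) (![(α q.1)⁻¹, 0] q.2)
      (weightMatrix γ p.1 q.1) (biasCompensation γ α β σ p q)⟩
  have hKb0 : ∀ p q, 0 ≤ Kb p q := fun p q =>
    (integral_nonneg fun ω => sq_nonneg _).trans (hKb 0 p q).2
  refine ⟨pastFiltration hZ time, ∑ p, ∑ q, Kb p q, ⟨fun t p q => ?_, fun t p q => ?_,
    fun t p q => (hKb t p q).1, fun t p q => ?_, fun t p q => ?_, fun ω => rfl, fun t ω => ?_⟩⟩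
  -- The σ-algebra at index `t` contains only samples of times strictly before `t`; those of time
  -- `t` enter at `t + 1`.
  · exact hmeas t _ (Nat.lt_succ_self t) p q
  · refine indep_of_indep_of_le_left (indep_observed hZ hind time (S := {t}) (T := Set.Iio t)
      (by simp)) ?_
    exact measurable_iff_comap_le.1 (hmeas t {t} rfl p q)
  · have hm := ((hasMean_affine_mul (hxm t) (hxx t) (hηm p.1 t) (hηm q.1 t) (hxe p.1 t) (hxe q.1 t)
      (hee p.1 q.1 t) (![α p.1 * β p.1, β p.1 ^ 2 + 1] p.2) (![α p.1 ^ 2, α p.1 * β p.1] p.2)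
      (![α p.1, β p.1] p.2) (![0, 1] q.2) (![1, 0] q.2) (![(α q.1)⁻¹, 0] q.2)).const_mul
      (weightMatrix γ p.1 q.1)).add (HasMean.const (biasCompensation γ α β σ p q))
    rw [mean_identity (fun i => hγzero i i (hloop i)) hα β σ xbar s p q] at hm
    exact (hm.congr (fun ω => by
      simp only [iterationMatrix, Matrix.of_apply, regressor, outputCoeff]; ring) rfl).2
  · exact (hKb t p q).2.trans ((Finset.single_le_sum (f := fun q => Kb p q)
      (fun q _ => hKb0 p q) (Finset.mem_univ q)).trans (Finset.single_le_sum
      (f := fun p => ∑ q, Kb p q) (fun p _ => Finset.sum_nonneg fun q _ => hKb0 p q)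
      (Finset.mem_univ p)))
  · exact rhoOf_step hγzero hα β σ (δ t) (x t ω) (fun i => η i t ω) _

/-! ### The convergence theorem -/

theorem theorem5 {Ω : Type*} [MeasurableSpace Ω] (μ : Measure Ω) [IsProbabilityMeasure μ]
    (n : ℕ)
    -- the communication graph (without self-loops) and the weights of its arcs
    (G : Digraph (Fin n)) (hloop : ∀ i, ¬ G.Adj i i)
    (γ : Fin n → Fin n → ℝ)
    (hγpos : ∀ i j, G.Adj j i → 0 < γ i j)
    (hγzero : ∀ i j, ¬ G.Adj j i → γ i j = 0)
    (hG : HasSpanningTree G)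
    -- the sensor gains and offsets
    (α β : Fin n → ℝ) (hα : ∀ i, α i ≠ 0)
    -- the i.i.d. signal with positive variance
    (x : ℕ → Ω → ℝ) (xbar s : ℝ)
    (hx_meas : ∀ t, Measurable (x t))
    (hx_indep : iIndepFun x μ)
    (hx_ident : ∀ t, IdentDistrib (x t) (x 0) μ μ)
    (hx_four : ∀ t, MemLp (x t) 4 μ)
    (hx_mean : ∀ t, ∫ ω, x t ω ∂μ = xbar)
    (hx_sq : ∀ t, ∫ ω, x t ω ^ 2 ∂μ = s ^ 2)
    (hx_var : 0 < s ^ 2 - xbar ^ 2)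
    -- the i.i.d. zero-mean measurement noises with variances σ_i²
    (η : Fin n → ℕ → Ω → ℝ) (σ : Fin n → ℝ)
    (hη_meas : ∀ i t, Measurable (η i t))
    (hη_indep : iIndepFun (fun p : Fin n × ℕ => η p.1 p.2) μ)
    (hη_ident : ∀ i t, IdentDistrib (η i t) (η i 0) μ μ)
    (hη_four : ∀ i t, MemLp (η i t) 4 μ)
    (hη_mean : ∀ i t, ∫ ω, η i t ω ∂μ = 0)
    (hη_sq : ∀ i t, ∫ ω, η i t ω ^ 2 ∂μ = σ i ^ 2)
    (hxη : IndepFun (fun ω (t : ℕ) => x t ω) (fun ω (p : Fin n × ℕ) => η p.1 p.2 ω) μ)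
    -- the step sizes
    (δ : ℕ → ℝ) (hδ_pos : ∀ t, 0 < δ t)
    (hδ_sum : Tendsto (fun N => ∑ t ∈ Finset.range N, δ t) atTop atTop)
    (hδ_sq : Summable fun t => δ t ^ 2) :
    (∃! p : (Fin n × Fin 2 → ℝ) × (Fin n × Fin 2 → ℝ),
      IsNormalizedLeftPair (BBar γ α β xbar s) p.1 p.2) ∧
    ∃ w₁ w₂ : Ω → ℝ, Measurable w₁ ∧ Measurable w₂ ∧ MemLp w₁ 2 μ ∧ MemLp w₂ 2 μ ∧
      TendstoMeanSquare μ (rhoHat G γ α β σ δ x η)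
        (fun ω => w₁ ω • vecI1 n + w₂ ω • vecI2 n) ∧
      TendstoAlmostSurely μ (rhoHat G γ α β σ δ x η)
        (fun ω => w₁ ω • vecI1 n + w₂ ω • vecI2 n) ∧
      ∀ p₁ p₂ : Fin n × Fin 2 → ℝ, IsNormalizedLeftPair (BBar γ α β xbar s) p₁ p₂ →
        ∫ ω, w₁ ω ∂μ = p₁ ⬝ᵥ rhoOf α β (thetaInit n) ∧
        ∫ ω, w₂ ω ∂μ = p₂ ⬝ᵥ rhoOf α β (thetaInit n) := by
  obtain ⟨r, hr⟩ := exists_root hG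
  have hγ := weight_nonneg hγpos hγzero
  have hpair := existsUnique_normalizedLeftPair hγpos hγ hr hα (β := β) hx_var
  refine ⟨hpair, ?_⟩
  obtain ⟨⟨p₁, p₂⟩, hp, huniq⟩ := hpair
  obtain ⟨ε, hε, hT⟩ := exists_tendsto_pow_zero hγpos hγ hr hα hx_var hp
  obtain ⟨ℱ, K, hrec⟩ := rhoHat_isRandomLinearRecursion hloop hγzero β hα hx_meas hx_indep hx_ident
    hx_four hx_mean hx_sq hη_meas hη_indep hη_ident hη_four hη_mean hη_sq hxη δ
  obtain ⟨M, hMm, hM2, hM0, hms, has⟩ := hrec.exists_limit hδ_pos hδ_sum hδ_sq hε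
    (consensusProj_mul hp) (mul_consensusProj γ α β xbar s p₁ p₂) (consensusProj_mul_self hp) hT
  set ρ₀ := rhoOf α β (thetaInit n)
  have hX2 : ∀ q, MemLp (fun ω => (ρ₀ + M ω) q) 2 μ := fun q => (memLp_const (ρ₀ q)).add (hM2 q)
  have hmeas : ∀ p : Fin n × Fin 2 → ℝ, Measurable fun ω => p ⬝ᵥ (ρ₀ + M ω) := fun p =>
    Finset.measurable_fun_sum _ fun q _ => ((hMm q).const_add (ρ₀ q)).const_mul (p q)
  have hmem : ∀ p : Fin n × Fin 2 → ℝ, MemLp (fun ω => p ⬝ᵥ (ρ₀ + M ω)) 2 μ := fun p =>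
    memLp_finsetSum _ fun q _ => (hX2 q).const_mul (p q)
  have hmean : ∀ p : Fin n × Fin 2 → ℝ, ∫ ω, p ⬝ᵥ (ρ₀ + M ω) ∂μ = p ⬝ᵥ ρ₀ := fun p => by
    simp only [dotProduct]
    rw [integral_finsetSum _ fun q _ => ((hX2 q).const_mul (p q)).integrable (by norm_num)]
    refine Finset.sum_congr rfl fun q _ => ?_
    simp only [Pi.add_apply]
    rw [integral_const_mul, integral_add (integrable_const _) ((hM2 q).integrable (by norm_num)),
      hM0]
    simp
  -- The limit P(ρ₀ + M) has coordinates p_k'(ρ₀ + M) along `vecI1` and `vecI2`; these are the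
  -- variables w_k.
  simp only [consensusProj_mulVec] at hms has
  refine ⟨fun ω => p₁ ⬝ᵥ (ρ₀ + M ω), fun ω => p₂ ⬝ᵥ (ρ₀ + M ω), hmeas _, hmeas _, hmem _, hmem _,
    hms, has, fun q₁ q₂ hq => ?_⟩
  obtain ⟨rfl, rfl⟩ := Prod.mk.inj (huniq (q₁, q₂) hq)
  exact ⟨hmean _, hmean _⟩
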